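/- Let $(\alpha,\mu)$ be a $\sigma$-finite measure space and let $X_0,X_1$ be complex Banach Köthe function spaces over it (complete normed $L_\infty(\mu)$-submodules of $L_0(\mu)$ whose norm satisfies $\|f\|\le\|g\|$ whenever $|f|\le|g|$). Assume the pair is regular, i.e. $X_0\cap X_1$ is dense in $X_0$ and in $X_1$. Let $0<\theta<1$ and let $X=[X_0,X_1]_\theta$ be the complex interpolation space, that is, the range of the evaluation $\delta_\theta$ on the Calderón space $\mathcal F(X_0,X_1)$ on the strip $0\le \mathrm{Re}\,z\le 1$, with the quotient norm. Let $\Omega_\theta=\delta_\theta'B$ be the induced centralizer on $X$, where $B:X\to\mathcal F(X_0,X_1)$ is any homogeneous bounded selection for $\delta_\theta$. For a Köthe space $Y$ let $Y^*=\{g\in L_0: \|g\|_{Y^*}=\sup_{\|y\|_Y\le1}\int|yg|\,d\mu<\infty\}$ be its Köthe dual, and call $f=yy^*$ with $y\in Y$, $y^*\in Y^*$ a $K$-optimal factorization of $f\in L_1(\mu)$ if $\|y\|_Y\|y^*\|_{Y^*}\le K\|f\|_1$. Let $\Omega^{[1]}$ be an upload of $\Omega_\theta$ to $L_1(\mu)$,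 i.e. a map on $L_1(\mu)$ such that for some constant $K'$ and every $f\in L_1(\mu)$ one has $\Omega^{[1]}(f)=\Omega_\theta(x)\,x^*$ for some $K'$-optimal factorization $f=xx^*$ with $x\in X$, $x^*\in X^*$. Then, up to a bounded map, $\Omega^{[1]}(f)=f(\log|x_1|-\log|x_0|)$. Precisely: for every $K\ge 0$ there is a constant $C$ such that for every $f\in L_1(\mu)$ and all $K$-optimal factorizations $|f|=x_0x_0^*=x_1x_1^*$ with $x_i\in X_i$, $x_i^*\in X_i^*$, normalized so that $\|x_0\|_{X_0}\le K\|x_1\|_{X_1}$ and $\|x_1\|_{X_1}\le K\|x_0\|_{X_0}$, $$\bigl\|\Omega^{[1]}(f)-f\,(\log |x_1|-\log |x_0|)\bigr\|_{L_1(\mu)}\le C\,\|f\|_1 .$$ (The expression $f(\log|x_1|-\log|x_0|)$ is taken to be $0$ where $f=0$.) -/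

import Mathlib

open MeasureTheory Filter Topology
open scoped ENNReal NNReal

noncomputable section

/-- A complex Banach Köthe function space over `(α, μ)`, presented by its extended norm on `L_0(μ)`:
the space is `X = {f : nrm f < ∞}`. By monotonicity of the norm, `X` is an `L_∞`-submodule of
`L_0`, and `nrm` is a complete lattice norm on it. -/
structure KotheSpace {α : Type*} [MeasurableSpace α] (μ : Measure α) where
  nrm : (α →ₘ[μ] ℂ) → ℝ≥0∞
  nrm_eq_zero : ∀ f, nrm f = 0 ↔ f = 0
  nrm_smul : ∀ (c : ℂ) (f : α →ₘ[μ] ℂ), nrm (c • f) = ‖c‖ₑ * nrm f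
  nrm_add_le : ∀ f g, nrm (f + g) ≤ nrm f + nrm g
  nrm_mono : ∀ f g : α →ₘ[μ] ℂ, (∀ᵐ ω ∂μ, ‖f ω‖ ≤ ‖g ω‖) → nrm f ≤ nrm g
  complete : ∀ u : ℕ → (α →ₘ[μ] ℂ), (∀ n, nrm (u n) < ∞) →
    (∀ ε : ℝ≥0∞, 0 < ε → ∃ N, ∀ m ≥ N, ∀ n ≥ N, nrm (u m - u n) < ε) →
    ∃ f, nrm f < ∞ ∧ Tendsto (fun n => nrm (u n - f)) atTop (𝓝 0)

namespace KotheSpace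

variable {α : Type*} [MeasurableSpace α] {μ : Measure α}

/-- The extended norm of `L_1(μ)`. -/
def l1Norm (f : α →ₘ[μ] ℂ) : ℝ≥0∞ := ∫⁻ ω, ‖f ω‖ₑ ∂μ

/-- The modulus `|f|`, as an element of `L_0`. -/
def modulus (f : α →ₘ[μ] ℂ) : α →ₘ[μ] ℂ :=
  AEEqFun.comp (fun z : ℂ => ((‖z‖ : ℝ) : ℂ)) (by fun_prop) f

/-- The extended norm of the Köthe dual `X^*` of the space `X = {f : ρ f < ∞}`:
`‖g‖ = sup {∫ |f g| dμ : ‖f‖_X ≤ 1}`. -/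
def kotheDual (ρ : (α →ₘ[μ] ℂ) → ℝ≥0∞) (g : α →ₘ[μ] ℂ) : ℝ≥0∞ :=
  ⨆ (f : α →ₘ[μ] ℂ) (_ : ρ f ≤ 1), l1Norm (f * g)

/-- `f = x x^*` is a `K`-optimal factorization of `f` in `L_1 = X X^*`, where
`X = {f : ρ f < ∞}`: here `x ∈ X`, `x^* ∈ X^*` and `‖x‖_X ‖x^*‖_{X^*} ≤ K ‖f‖_1`. -/
structure IsAlmostOptimal (ρ : (α →ₘ[μ] ℂ) → ℝ≥0∞) (K : ℝ≥0) (f x xs : α →ₘ[μ] ℂ) : Prop where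
  eq_mul : f = x * xs
  mem : ρ x < ∞
  mem_dual : kotheDual ρ xs < ∞
  le : ρ x * kotheDual ρ xs ≤ K * l1Norm f

/-- The pair `(X_0, X_1)` is regular: `X_0 ∩ X_1` is dense in `X_0` and in `X_1`. -/
def IsRegularPair (X₀ X₁ : KotheSpace μ) : Prop :=
  (∀ f, X₀.nrm f < ∞ → ∀ ε : ℝ≥0∞, 0 < ε →
    ∃ g, X₀.nrm g < ∞ ∧ X₁.nrm g < ∞ ∧ X₀.nrm (f - g) < ε) ∧
  (∀ f, X₁.nrm f < ∞ → ∀ ε : ℝ≥0∞, 0 < ε →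
    ∃ g, X₀.nrm g < ∞ ∧ X₁.nrm g < ∞ ∧ X₁.nrm (f - g) < ε)

/-- The extended norm of the sum `X_0 + X_1`. -/
def sumNorm (X₀ X₁ : KotheSpace μ) (f : α →ₘ[μ] ℂ) : ℝ≥0∞ :=
  ⨅ (a : α →ₘ[μ] ℂ) (b : α →ₘ[μ] ℂ) (_ : a + b = f), X₀.nrm a + X₁.nrm b

/-- `F` has complex derivative `d` at `z`, in the norm of `X_0 + X_1`. -/
def HasDerivInSum (X₀ X₁ : KotheSpace μ) (F : ℂ → (α →ₘ[μ] ℂ)) (z : ℂ) (d : α →ₘ[μ] ℂ) : Prop :=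
  Tendsto (fun w => sumNorm X₀ X₁ ((w - z)⁻¹ • (F w - F z) - d)) (𝓝[≠] z) (𝓝 0)

/-- The open strip `0 < Re z < 1`. -/
def strip : Set ℂ := {z | 0 < z.re ∧ z.re < 1}

/-- The closed strip `0 ≤ Re z ≤ 1`. -/
def closedStrip : Set ℂ := {z | 0 ≤ z.re ∧ z.re ≤ 1}

/-- The Calderón space `ℱ(X_0, X_1)`: functions that are bounded and continuous from the closed
strip to `X_0 + X_1`, holomorphic in the open strip, and whose restriction to the line
`Re z = j` is bounded and continuous with values in `X_j`, for `j = 0, 1`. Values outside the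
closed strip are irrelevant. -/
structure InCalderon (X₀ X₁ : KotheSpace μ) (F : ℂ → (α →ₘ[μ] ℂ)) : Prop where
  bounded : ∃ M : ℝ≥0, ∀ z ∈ closedStrip, sumNorm X₀ X₁ (F z) ≤ M
  continuousOn : ∀ z ∈ closedStrip,
    Tendsto (fun w => sumNorm X₀ X₁ (F w - F z)) (𝓝[closedStrip] z) (𝓝 0)
  holomorphic : ∀ z ∈ strip, ∃ d, HasDerivInSum X₀ X₁ F z d
  bounded_left : ∃ M : ℝ≥0, ∀ t : ℝ, X₀.nrm (F (t * Complex.I)) ≤ M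
  continuous_left : ∀ t : ℝ,
    Tendsto (fun s : ℝ => X₀.nrm (F (s * Complex.I) - F (t * Complex.I))) (𝓝 t) (𝓝 0)
  bounded_right : ∃ M : ℝ≥0, ∀ t : ℝ, X₁.nrm (F (1 + t * Complex.I)) ≤ M
  continuous_right : ∀ t : ℝ,
    Tendsto (fun s : ℝ => X₁.nrm (F (1 + s * Complex.I) - F (1 + t * Complex.I))) (𝓝 t) (𝓝 0)

/-- The norm of the Calderón space. -/
def calderonNorm (X₀ X₁ : KotheSpace μ) (F : ℂ → (α →ₘ[μ] ℂ)) : ℝ≥0∞ :=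
  max (⨆ t : ℝ, X₀.nrm (F (t * Complex.I))) (⨆ t : ℝ, X₁.nrm (F (1 + t * Complex.I)))

/-- The extended norm of the complex interpolation space `[X_0, X_1]_θ`: the quotient norm of the
evaluation at `θ` on the Calderón space (and `∞` off its range). -/
def interpNorm (X₀ X₁ : KotheSpace μ) (θ : ℝ) (x : α →ₘ[μ] ℂ) : ℝ≥0∞ :=
  ⨅ (F : ℂ → (α →ₘ[μ] ℂ)) (_ : InCalderon X₀ X₁ F) (_ : F θ = x), calderonNorm X₀ X₁ F

/-- `Ω` is a differential of the pair `(X_0, X_1)` at `θ`: on `X_θ = [X_0, X_1]_θ` it is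
`Ω x = (B x)'(θ)` for some homogeneous bounded selection `B : X_θ → ℱ(X_0, X_1)` of the
evaluation at `θ`. Values of `Ω` and `B` off `X_θ` are irrelevant. -/
def IsDifferential (X₀ X₁ : KotheSpace μ) (θ : ℝ) (Ω : (α →ₘ[μ] ℂ) → (α →ₘ[μ] ℂ)) : Prop :=
  ∃ (B : (α →ₘ[μ] ℂ) → ℂ → (α →ₘ[μ] ℂ)) (K : ℝ≥0),
    (∀ x, interpNorm X₀ X₁ θ x < ∞ →
      InCalderon X₀ X₁ (B x) ∧ B x θ = x ∧
      calderonNorm X₀ X₁ (B x) ≤ K * interpNorm X₀ X₁ θ x ∧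
      HasDerivInSum X₀ X₁ (B x) θ (Ω x)) ∧
    (∀ (c : ℂ) (x : α →ₘ[μ] ℂ), interpNorm X₀ X₁ θ x < ∞ →
      ∀ z ∈ closedStrip, B (c • x) z = c • B x z)

/-- `U` is an upload `Ω^{[1]}` to `L_1` of the map `Ω` on `X = {f : ρ f < ∞}`: for every
`f ∈ L_1` one has `U f = Ω(x) x^*` for some almost optimal factorization `f = x x^*` in
`L_1 = X X^*`, with one constant for all `f`. -/
def IsUpload (ρ : (α →ₘ[μ] ℂ) → ℝ≥0∞) (Ω U : (α →ₘ[μ] ℂ) → (α →ₘ[μ] ℂ)) : Prop :=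
  ∃ K : ℝ≥0, ∀ f, l1Norm f < ∞ →
    ∃ x xs, IsAlmostOptimal ρ K f x xs ∧ U f = Ω x * xs

end KotheSpace

end

/-! Put L = log|x₁| - log|x₀| and let X_θ be the interpolation space. If a function of the Calderón
space vanishes at θ, then dividing it by z - θ keeps it in the Calderón space, so its derivative at
θ lies in X_θ with norm control (`interpNorm_deriv_le`). Hence two Calderón functions with the same
value at θ have derivatives at θ that are close in X_θ (`IsDifferential.exists_interpNorm_sub_le`),
and Ω commutes with bounded multipliers up to a bounded error
(`IsDifferential.exists_interpNorm_commutator_le`). The commutation makes Ω(x)x^* depend only on the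
product xx^*, up to a bounded error in L_1 (`l1Norm_factorization_sub_le`): two factorizations are
compared through a common majorant of x and y.

The factorization chosen by the upload may therefore be replaced by u = x₀ exp(θL), whose modulus is
|x₀|^(1-θ)|x₁|^θ, and g = f/u. The function F(z) = exp((z-θ)L)u has modulus |x₀| on the left edge
and |x₁| on the right edge, with F(θ) = u and F'(θ) = Lu. So Ω(u)g differs from Lug = fL by a
bounded amount. That g lies in the Köthe dual of X_θ comes from the three lines theorem applied to ∫
exp(-(z-θ)L) G(z) s g dμ, with G in the Calderón space and s a phase (`kotheDual_interpNorm_le`).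

Since L may be unbounded, the argument runs where |L| ≤ n (`exists_factorization_on_truncation`,
`setLIntegral_truncation_le`). The bounds do not depend on n, and monotone convergence gives the
theorem. Most of the rest makes X_0 + X_1 a Banach space, so that complex analysis with vector
values applies. -/

noncomputable section

namespace KotheSpace

variable {α : Type*} [MeasurableSpace α] {μ : Measure α}

section

/-! ### Extended norms and the Banach space of their finite elements -/

/-- An extended norm on a complex vector space. -/
structure ExtNorm (V : Type*) [AddCommGroup V] [Module ℂ V] where
  toFun : V → ℝ≥0∞
  map_zero : toFun 0 = 0
  eq_zero : ∀ v, toFun v = 0 → v = 0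
  smul_le : ∀ (c : ℂ) v, toFun (c • v) ≤ ‖c‖ₑ * toFun v
  add_le : ∀ v w, toFun (v + w) ≤ toFun v + toFun w

namespace ExtNorm

variable {V : Type*} [AddCommGroup V] [Module ℂ V] (N : ExtNorm V)

lemma map_neg (v : V) : N.toFun (-v) = N.toFun v := by
  have h : ∀ v, N.toFun (-v) ≤ N.toFun v := fun v => by
    simpa using N.smul_le (-1) v
  exact le_antisymm (h v) (by simpa using h (-v))

lemma sub_le (v w : V) : N.toFun (v - w) ≤ N.toFun v + N.toFun w := by
  rw [sub_eq_add_neg, ← N.map_neg w]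
  exact N.add_le _ _

lemma smul_lt_top (c : ℂ) {v : V} (hv : N.toFun v < ∞) : N.toFun (c • v) < ∞ :=
  (N.smul_le c v).trans_lt (ENNReal.mul_lt_top (by simp) hv)

lemma sub_lt_top {v w : V} (hv : N.toFun v < ∞) (hw : N.toFun w < ∞) : N.toFun (v - w) < ∞ :=
  (N.sub_le v w).trans_lt (ENNReal.add_lt_top.2 ⟨hv, hw⟩)

/-- The elements of finite norm. -/
def finite : Submodule ℂ V where
  carrier := {v | N.toFun v < ∞}
  add_mem' {v w} hv hw := (N.add_le v w).trans_lt (ENNReal.add_lt_top.2 ⟨hv, hw⟩)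
  zero_mem' := by simp [N.map_zero]
  smul_mem' c v hv := N.smul_lt_top c hv

/-- The normed space of the elements of finite norm. -/
def Space : Type _ := N.finite

instance : AddCommGroup N.Space := inferInstanceAs (AddCommGroup N.finite)

instance : Module ℂ N.Space := inferInstanceAs (Module ℂ N.finite)

/-- The inclusion of the normed space into the ambient vector space. -/
def incl : N.Space →ₗ[ℂ] V := N.finite.subtype

lemma incl_lt_top (x : N.Space) : N.toFun (N.incl x) < ∞ := x.2

lemma incl_injective : Function.Injective N.incl := Subtype.val_injective

instance : NormedAddCommGroup N.Space :=
  AddGroupNorm.toNormedAddCommGroup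
    { toFun := fun x => (N.toFun (N.incl x)).toReal
      map_zero' := by simp [N.map_zero]
      add_le' := fun x y => by
        rw [← ENNReal.toReal_add (N.incl_lt_top x).ne (N.incl_lt_top y).ne, _root_.map_add]
        exact ENNReal.toReal_mono
          (ENNReal.add_lt_top.2 ⟨N.incl_lt_top x, N.incl_lt_top y⟩).ne (N.add_le _ _)
      neg' := fun x => by rw [_root_.map_neg, N.map_neg]
      eq_zero_of_map_eq_zero' := fun x hx => by
        apply N.incl_injective
        rw [_root_.map_zero]
        refine N.eq_zero _ ?_
        rcases (ENNReal.toReal_eq_zero_iff _).1 hx with h | h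
        · exact h
        · exact absurd h (N.incl_lt_top x).ne }

lemma norm_def (x : N.Space) : ‖x‖ = (N.toFun (N.incl x)).toReal := rfl

lemma enorm_eq (x : N.Space) : ‖x‖ₑ = N.toFun (N.incl x) := by
  rw [← ofReal_norm, norm_def, ENNReal.ofReal_toReal (N.incl_lt_top x).ne]

instance : NormedSpace ℂ N.Space where
  norm_smul_le c x := by
    rw [norm_def, norm_def, _root_.map_smul]
    have h := N.smul_le c (N.incl x)
    have := ENNReal.toReal_mono (ENNReal.mul_lt_top (by simp) (N.incl_lt_top x)).ne h
    simpa [ENNReal.toReal_mul] using this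

open Classical in
/-- The element of the normed space with a given value, and zero if that has infinite norm. -/
def lift (v : V) : N.Space := if h : N.toFun v < ∞ then ⟨v, h⟩ else 0

lemma incl_lift {v : V} (h : N.toFun v < ∞) : N.incl (N.lift v) = v := by
  have : N.lift v = ⟨v, h⟩ := dif_pos h
  rw [this]
  rfl

lemma tendsto_iff {ι : Type*} {l : Filter ι} {u : ι → N.Space} {x : N.Space} :
    Tendsto u l (𝓝 x) ↔ Tendsto (fun i => N.toFun (N.incl (u i) - N.incl x)) l (𝓝 0) := by
  rw [tendsto_iff_edist_tendsto_0]
  simp_rw [edist_eq_enorm_sub, enorm_eq, _root_.map_sub]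

end ExtNorm

/-! ### Algebra in `L_0` -/

lemma mul_add_fun (a f g : α →ₘ[μ] ℂ) : a * (f + g) = a * f + a * g := by
  apply AEEqFun.ext
  filter_upwards [AEEqFun.coeFn_mul a (f + g), AEEqFun.coeFn_add f g,
    AEEqFun.coeFn_add (a * f) (a * g), AEEqFun.coeFn_mul a f, AEEqFun.coeFn_mul a g]
    with ω h1 h2 h3 h4 h5
  simp only [h1, h2, h3, h4, h5, Pi.mul_apply, Pi.add_apply, mul_add]

lemma smul_mul_fun (c : ℂ) (f g : α →ₘ[μ] ℂ) : (c • f) * g = c • (f * g) := by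
  apply AEEqFun.ext
  filter_upwards [AEEqFun.coeFn_mul (c • f) g, AEEqFun.coeFn_smul c f,
    AEEqFun.coeFn_smul c (f * g), AEEqFun.coeFn_mul f g] with ω h1 h2 h3 h4
  simp only [h1, h2, h3, h4, Pi.mul_apply, Pi.smul_apply, smul_eq_mul, mul_assoc]

lemma mul_smul_fun (c : ℂ) (f g : α →ₘ[μ] ℂ) : f * (c • g) = c • (f * g) := by
  rw [mul_comm, smul_mul_fun, mul_comm]

lemma mul_sub_fun (a f g : α →ₘ[μ] ℂ) : a * (f - g) = a * f - a * g := by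
  rw [eq_sub_iff_add_eq, ← mul_add_fun, sub_add_cancel]

lemma sub_mul_fun (f g a : α →ₘ[μ] ℂ) : (f - g) * a = f * a - g * a := by
  rw [mul_comm, mul_sub_fun, mul_comm a f, mul_comm a g]

lemma add_mul_fun (f g a : α →ₘ[μ] ℂ) : (f + g) * a = f * a + g * a := by
  rw [mul_comm, mul_add_fun, mul_comm a f, mul_comm a g]

/-- A measurable function, as an element of `L_0`. -/
def ofFun (f : α → ℂ) (hf : Measurable f) : α →ₘ[μ] ℂ := AEEqFun.mk f hf.aestronglyMeasurable

lemma coeFn_ofFun (f : α → ℂ) (hf : Measurable f) : ofFun (μ := μ) f hf =ᵐ[μ] f :=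
  AEEqFun.coeFn_mk _ _

lemma coeFn_modulus (f : α →ₘ[μ] ℂ) : modulus f =ᵐ[μ] fun ω => ((‖f ω‖ : ℝ) : ℂ) :=
  AEEqFun.coeFn_comp _ _ f

/-! ### Basic properties of the norms -/

variable (X X₀ X₁ : KotheSpace μ)

/-- The extended norm of a Köthe space. -/
def extNorm : ExtNorm (α →ₘ[μ] ℂ) where
  toFun := X.nrm
  map_zero := (X.nrm_eq_zero 0).2 rfl
  eq_zero v := (X.nrm_eq_zero v).1
  smul_le c v := (X.nrm_smul c v).le
  add_le := X.nrm_add_le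

lemma nrm_zero : X.nrm 0 = 0 := X.extNorm.map_zero

lemma nrm_mono_enorm {f g : α →ₘ[μ] ℂ} (h : ∀ᵐ ω ∂μ, ‖f ω‖ₑ ≤ ‖g ω‖ₑ) : X.nrm f ≤ X.nrm g := by
  refine X.nrm_mono f g ?_
  filter_upwards [h] with ω hω
  exact enorm_le_iff_norm_le.1 hω

lemma nrm_mul_le {φ : α →ₘ[μ] ℂ} {C : ℝ≥0} (hφ : ∀ᵐ ω ∂μ, ‖φ ω‖ ≤ C) (f : α →ₘ[μ] ℂ) :
    X.nrm (φ * f) ≤ C * X.nrm f := by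
  have h : X.nrm (φ * f) ≤ X.nrm (((C : ℝ) : ℂ) • f) := by
    refine X.nrm_mono _ _ ?_
    filter_upwards [hφ, AEEqFun.coeFn_mul φ f, AEEqFun.coeFn_smul (((C : ℝ) : ℂ)) f]
      with ω h1 h2 h3
    simp only [h2, h3, Pi.mul_apply, Pi.smul_apply, norm_mul, norm_smul]
    gcongr
    simpa using h1
  refine h.trans_eq ?_
  rw [X.nrm_smul]
  congr 1
  rw [enorm_eq_nnnorm]
  congr 1
  ext
  simp

/-- In a Köthe space, absolutely convergent series converge. -/
lemma exists_tendsto_sum (a : ℕ → α →ₘ[μ] ℂ) (ha : ∑' n, X.nrm (a n) ≠ ∞) :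
    ∃ s, Tendsto (fun N => X.nrm (∑ n ∈ Finset.range N, a n - s)) atTop (𝓝 0) := by
  have hsum : ∀ N k, X.nrm (∑ n ∈ Finset.range (N + k), a n - ∑ n ∈ Finset.range N, a n)
      ≤ ∑' n, X.nrm (a (n + N)) := fun N k => by
    refine le_trans ?_ (ENNReal.sum_le_tsum (Finset.range k))
    induction k with
    | zero => simp [X.nrm_zero]
    | succ k ih =>
      have : ∑ n ∈ Finset.range (N + (k + 1)), a n - ∑ n ∈ Finset.range N, a n
          = (∑ n ∈ Finset.range (N + k), a n - ∑ n ∈ Finset.range N, a n) + a (k + N) := by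
        rw [← add_assoc, Finset.sum_range_succ, add_comm k N]
        abel
      rw [this, Finset.sum_range_succ]
      exact (X.nrm_add_le _ _).trans (add_le_add ih le_rfl)
  have htail := ENNReal.tendsto_sum_nat_add (fun n => X.nrm (a n)) ha
  obtain ⟨s, -, hs⟩ := X.complete (fun N => ∑ n ∈ Finset.range N, a n)
    (fun N => by
      have := hsum 0 N
      simp only [Finset.range_zero, Finset.sum_empty, sub_zero, zero_add, add_zero] at this
      exact this.trans_lt (lt_top_iff_ne_top.2 ha)) (by
    intro ε hε
    obtain ⟨N, hN⟩ := (htail.eventually (gt_mem_nhds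
      (show (0 : ℝ≥0∞) < ε / 2 from ENNReal.half_pos (by simpa using hε.ne')))).exists
    refine ⟨N, fun m hm n hn => ?_⟩
    obtain ⟨k, rfl⟩ := Nat.exists_eq_add_of_le hm
    obtain ⟨l, rfl⟩ := Nat.exists_eq_add_of_le hn
    rw [← sub_sub_sub_cancel_right _ _ (∑ n ∈ Finset.range N, a n), ← ENNReal.add_halves (ε : ℝ≥0∞)]
    exact (X.extNorm.sub_le _ _).trans_lt
      (ENNReal.add_lt_add ((hsum N k).trans_lt hN) ((hsum N l).trans_lt hN)))
  exact ⟨s, hs⟩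

/-- Countable subadditivity of the norm of a Köthe space. -/
theorem nrm_le_tsum (f : α →ₘ[μ] ℂ) (g : ℕ → α →ₘ[μ] ℂ)
    (h : ∀ᵐ ω ∂μ, ‖f ω‖ₑ ≤ ∑' n, ‖g n ω‖ₑ) : X.nrm f ≤ ∑' n, X.nrm (g n) := by
  by_cases htop : ∑' n, X.nrm (g n) = ∞
  · rw [htop]
    exact le_top
  set S : ℕ → α →ₘ[μ] ℂ := fun N => ∑ n ∈ Finset.range N, modulus (g n) with hS
  have hmod : ∀ n, X.nrm (modulus (g n)) ≤ X.nrm (g n) := fun n => by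
    refine X.nrm_mono _ _ ?_
    filter_upwards [coeFn_modulus (g n)] with ω hω
    simp [hω]
  have hSω : ∀ᵐ ω ∂μ, ∀ N, S N ω = ((∑ n ∈ Finset.range N, ‖g n ω‖ : ℝ) : ℂ) := by
    rw [ae_all_iff]
    intro N
    induction N with
    | zero =>
      filter_upwards [AEEqFun.coeFn_zero (μ := μ) (β := ℂ) (α := α)] with ω hω
      simp [hS, hω]
    | succ N ih =>
      have : S (N + 1) = S N + modulus (g N) := Finset.sum_range_succ _ _
      rw [this]
      filter_upwards [ih, AEEqFun.coeFn_add (S N) (modulus (g N)), coeFn_modulus (g N)]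
        with ω h1 h2 h3
      rw [h2, Pi.add_apply, h1, h3, Finset.sum_range_succ]
      push_cast
      rfl
  have hSle : ∀ N, X.nrm (S N) ≤ ∑' n, X.nrm (g n) := fun N => by
    refine le_trans ?_ (ENNReal.sum_le_tsum (Finset.range N))
    induction N with
    | zero => simp [hS, X.nrm_zero]
    | succ N ih =>
      have : S (N + 1) = S N + modulus (g N) := Finset.sum_range_succ _ _
      rw [this, Finset.sum_range_succ]
      exact (X.nrm_add_le _ _).trans (add_le_add ih (hmod N))
  obtain ⟨s, hs⟩ := X.exists_tendsto_sum (fun n => modulus (g n))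
    (ne_top_of_le_ne_top htop (ENNReal.tsum_le_tsum hmod))
  -- Order replaces pointwise convergence here: the positive part of |S M| - |s| is dominated by |S
  -- N - s| for every N ≥ M, and the norms of these differences tend to 0.
  have hdom : ∀ M, ∀ᵐ ω ∂μ, ‖S M ω‖ ≤ ‖s ω‖ := by
    intro M
    set d : α →ₘ[μ] ℂ := ofFun (fun ω => ((max (‖S M ω‖ - ‖s ω‖) 0 : ℝ) : ℂ)) (by
      have := (S M).measurable
      have := s.measurable
      fun_prop) with hd
    have hdle : ∀ N ≥ M, X.nrm d ≤ X.nrm (S N - s) := by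
      intro N hN
      refine X.nrm_mono _ _ ?_
      filter_upwards [hSω, coeFn_ofFun (μ := μ) (fun ω => ((max (‖S M ω‖ - ‖s ω‖) 0 : ℝ) : ℂ)) _,
        AEEqFun.coeFn_sub (S N) s] with ω h1 h2 h3
      rw [hd, h2, h3, Pi.sub_apply, Complex.norm_real, Real.norm_of_nonneg (le_max_right _ _)]
      refine max_le ?_ (norm_nonneg _)
      have hpos : ∀ n, 0 ≤ ∑ i ∈ Finset.range n, ‖g i ω‖ :=
        fun n => Finset.sum_nonneg fun _ _ => norm_nonneg _
      have : ‖S M ω‖ ≤ ‖S N ω‖ := by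
        rw [h1, h1, Complex.norm_real, Complex.norm_real, Real.norm_of_nonneg (hpos _),
          Real.norm_of_nonneg (hpos _)]
        exact Finset.sum_le_sum_of_subset_of_nonneg (Finset.range_mono hN)
          fun _ _ _ => norm_nonneg _
      have := norm_sub_norm_le (S N ω) (s ω)
      linarith
    have hd0 : X.nrm d = 0 := by
      refine le_antisymm (ge_of_tendsto hs ?_) zero_le
      filter_upwards [eventually_ge_atTop M] with N hN using hdle N hN
    have hdz := (X.nrm_eq_zero d).1 hd0
    have hcoe := coeFn_ofFun (μ := μ) (fun ω => ((max (‖S M ω‖ - ‖s ω‖) 0 : ℝ) : ℂ)) (by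
      have := (S M).measurable
      have := s.measurable
      fun_prop)
    rw [← hd, hdz] at hcoe
    filter_upwards [hcoe, AEEqFun.coeFn_zero (μ := μ) (β := ℂ) (α := α)] with ω h1 h2
    rw [h2] at h1
    have h3 : max (‖S M ω‖ - ‖s ω‖) 0 = 0 := by
      have := h1.symm
      simpa only [Pi.zero_apply, Complex.ofReal_eq_zero] using this
    have := le_max_left (‖S M ω‖ - ‖s ω‖) 0
    linarith
  have hfs : X.nrm f ≤ X.nrm s := by
    refine X.nrm_mono_enorm ?_
    filter_upwards [h, hSω, ae_all_iff.2 hdom] with ω h1 h2 h3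
    refine h1.trans ?_
    rw [ENNReal.tsum_eq_iSup_nat]
    refine iSup_le fun N => ?_
    have h4 : ‖S N ω‖ₑ ≤ ‖s ω‖ₑ := enorm_le_iff_norm_le.2 (h3 N)
    refine le_trans (le_of_eq ?_) h4
    rw [h2, ← ofReal_norm, Complex.norm_real,
      Real.norm_of_nonneg (Finset.sum_nonneg fun _ _ => norm_nonneg _),
      ENNReal.ofReal_sum_of_nonneg fun _ _ => norm_nonneg _]
    simp
  refine hfs.trans ?_
  have hlim : Tendsto (fun N => ∑' n, X.nrm (g n) + X.nrm (S N - s)) atTop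
      (𝓝 (∑' n, X.nrm (g n) + 0)) := tendsto_const_nhds.add hs
  rw [add_zero] at hlim
  refine ge_of_tendsto' hlim fun N => ?_
  have : s = S N - (S N - s) := by abel
  calc X.nrm s = X.nrm (S N - (S N - s)) := by rw [← this]
    _ ≤ X.nrm (S N) + X.nrm (S N - s) := X.extNorm.sub_le _ _
    _ ≤ _ := by gcongr; exact hSle N

/-- On the set where the series diverges it dominates every constant k, so k times the norm of the
indicator stays below one finite number and the indicator is 0. -/
lemma ae_tsum_ne_top (g : ℕ → α →ₘ[μ] ℂ) (h : ∑' n, X.nrm (g n) ≠ ∞) :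
    ∀ᵐ ω ∂μ, ∑' n, ‖g n ω‖ₑ ≠ ∞ := by
  have hmeas : Measurable fun ω => ∑' n, ‖g n ω‖ₑ :=
    Measurable.tsum fun n => (g n).measurable.enorm
  set A : Set α := {ω | ∑' n, ‖g n ω‖ₑ = ∞} with hA
  have hAm : MeasurableSet A := hmeas (measurableSet_singleton ∞)
  set e : α →ₘ[μ] ℂ := ofFun (A.indicator fun _ => 1) (measurable_const.indicator hAm) with he
  have hcoe := coeFn_ofFun (μ := μ) (A.indicator fun _ => (1 : ℂ)) (measurable_const.indicator hAm)
  have hk : ∀ k : ℕ, k * X.nrm e ≤ ∑' n, X.nrm (g n) := fun k => by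
    have h1 : X.nrm ((k : ℂ) • e) = k * X.nrm e := by
      rw [X.nrm_smul]
      congr 1
      rw [enorm_eq_nnnorm]
      simp
    rw [← h1]
    refine X.nrm_le_tsum _ _ ?_
    filter_upwards [AEEqFun.coeFn_smul (k : ℂ) e, hcoe] with ω h2 h3
    rw [h2, Pi.smul_apply, he, h3]
    by_cases hω : ω ∈ A
    · rw [show ∑' n, ‖g n ω‖ₑ = ∞ from hω]
      exact le_top
    · simp [hω]
  have he0 : X.nrm e = 0 := by
    by_contra hne
    obtain ⟨k, hk'⟩ := ENNReal.exists_nat_mul_gt hne h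
    exact absurd (hk k) (not_le.2 hk')
  have hez := (X.nrm_eq_zero e).1 he0
  rw [← he, hez] at hcoe
  filter_upwards [hcoe, AEEqFun.coeFn_zero (μ := μ) (β := ℂ) (α := α)] with ω h1 h2 h3
  rw [h2] at h1
  have : ω ∈ A := h3
  simp [this] at h1

/-! ### The sum of two Köthe spaces -/

lemma sumNorm_le_add {a b f : α →ₘ[μ] ℂ} (h : a + b = f) :
    sumNorm X₀ X₁ f ≤ X₀.nrm a + X₁.nrm b :=
  (iInf_le _ a).trans ((iInf_le _ b).trans (iInf_le _ h))

lemma exists_of_sumNorm_lt {f : α →ₘ[μ] ℂ} {r : ℝ≥0∞} (h : sumNorm X₀ X₁ f < r) :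
    ∃ a b, a + b = f ∧ X₀.nrm a + X₁.nrm b < r := by
  simp only [sumNorm, iInf_lt_iff] at h
  obtain ⟨a, b, hab, hlt⟩ := h
  exact ⟨a, b, hab, hlt⟩

lemma sumNorm_le_left (f : α →ₘ[μ] ℂ) : sumNorm X₀ X₁ f ≤ X₀.nrm f := by
  simpa [X₁.nrm_zero] using sumNorm_le_add X₀ X₁ (add_zero f)

lemma mul_eq_zero_of_norm_le_zero {φ : α →ₘ[μ] ℂ} (hφ : ∀ᵐ ω ∂μ, ‖φ ω‖ ≤ (0 : ℝ≥0))
    (f : α →ₘ[μ] ℂ) : φ * f = 0 := by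
  apply AEEqFun.ext
  filter_upwards [AEEqFun.coeFn_mul φ f, hφ, AEEqFun.coeFn_zero (μ := μ) (β := ℂ) (α := α)]
    with ω h1 h2 h3
  have h4 : φ ω = 0 := norm_le_zero_iff.1 (by simpa using h2)
  simp [h1, h3, h4]

lemma sumNorm_mul_le {φ : α →ₘ[μ] ℂ} {C : ℝ≥0} (hφ : ∀ᵐ ω ∂μ, ‖φ ω‖ ≤ C) (f : α →ₘ[μ] ℂ) :
    sumNorm X₀ X₁ (φ * f) ≤ C * sumNorm X₀ X₁ f := by
  rcases eq_or_ne C 0 with rfl | hC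
  · rw [mul_eq_zero_of_norm_le_zero hφ]
    exact (sumNorm_le_left X₀ X₁ 0).trans (by simp [X₀.nrm_zero])
  have h0 : (C : ℝ≥0∞) ≠ 0 := by simpa using hC
  have h1 : (C : ℝ≥0∞) ≠ ∞ := by simp
  conv_rhs => rw [sumNorm]
  simp_rw [ENNReal.mul_iInf_of_ne h0 h1]
  refine le_iInf fun a => le_iInf fun b => le_iInf fun hab => ?_
  rw [← hab, mul_add_fun, mul_add]
  exact (sumNorm_le_add X₀ X₁ rfl).trans
    (add_le_add (X₀.nrm_mul_le hφ a) (X₁.nrm_mul_le hφ b))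

lemma sumNorm_smul_le (c : ℂ) (f : α →ₘ[μ] ℂ) :
    sumNorm X₀ X₁ (c • f) ≤ ‖c‖ₑ * sumNorm X₀ X₁ f := by
  have h : c • f = (c • (1 : α →ₘ[μ] ℂ)) * f := by rw [smul_mul_fun, one_mul]
  rw [h, enorm_eq_nnnorm]
  refine sumNorm_mul_le X₀ X₁ ?_ f
  filter_upwards [AEEqFun.coeFn_smul c (1 : α →ₘ[μ] ℂ),
    AEEqFun.coeFn_one (μ := μ) (β := ℂ) (α := α)] with ω h1 h2
  simp [h1, h2]

lemma sumNorm_add_le (f g : α →ₘ[μ] ℂ) :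
    sumNorm X₀ X₁ (f + g) ≤ sumNorm X₀ X₁ f + sumNorm X₀ X₁ g := by
  conv_rhs => rw [sumNorm, sumNorm]
  simp_rw [ENNReal.iInf_add, ENNReal.add_iInf]
  refine le_iInf fun a => le_iInf fun b => le_iInf fun hab => le_iInf fun c => le_iInf fun d =>
    le_iInf fun hcd => ?_
  refine (sumNorm_le_add X₀ X₁ (a := a + c) (b := b + d) ?_).trans ?_
  · rw [← hab, ← hcd]
    abel
  · refine (add_le_add (X₀.nrm_add_le a c) (X₁.nrm_add_le b d)).trans_eq ?_
    ring

lemma tsum_half_pow : ∑' n : ℕ, (2⁻¹ : ℝ≥0∞) ^ n ≠ ∞ := by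
  rw [ENNReal.tsum_geometric, ENNReal.one_sub_inv_two, inv_inv]
  simp

/-- Decompositions f = a n + b n with norms below 2⁻ⁿ are summable, so a n and b n tend to 0 almost
everywhere. This plays the role of a continuous embedding into L_0. -/
lemma eq_zero_of_sumNorm_eq_zero (f : α →ₘ[μ] ℂ) (h : sumNorm X₀ X₁ f = 0) : f = 0 := by
  have hex : ∀ n : ℕ, ∃ a b, a + b = f ∧ X₀.nrm a + X₁.nrm b < (2⁻¹ : ℝ≥0∞) ^ n := fun n =>
    exists_of_sumNorm_lt X₀ X₁ (by rw [h]; exact ENNReal.pow_pos (by simp) n)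
  choose a b hab hlt using hex
  have ha := X₀.ae_tsum_ne_top a (ne_top_of_le_ne_top tsum_half_pow
    (ENNReal.tsum_le_tsum fun n => le_self_add.trans (hlt n).le))
  have hb := X₁.ae_tsum_ne_top b (ne_top_of_le_ne_top tsum_half_pow
    (ENNReal.tsum_le_tsum fun n => le_add_self.trans (hlt n).le))
  apply AEEqFun.ext
  filter_upwards [ha, hb, ae_all_iff.2 fun n => AEEqFun.coeFn_add (a n) (b n),
    AEEqFun.coeFn_zero (μ := μ) (β := ℂ) (α := α)] with ω h1 h2 h3 h4
  have h5 := (ENNReal.tendsto_atTop_zero_of_tsum_ne_top h1).add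
    (ENNReal.tendsto_atTop_zero_of_tsum_ne_top h2)
  rw [add_zero] at h5
  have h6 : ‖f ω‖ₑ ≤ 0 := ge_of_tendsto' h5 fun n => by
    have h7 : f ω = a n ω + b n ω := by
      rw [← Pi.add_apply, ← h3 n, hab n]
    rw [h7]
    exact enorm_add_le _ _
  rw [h4]
  simpa using h6

/-- The extended norm of the sum of two Köthe spaces. -/
def sumExtNorm : ExtNorm (α →ₘ[μ] ℂ) where
  toFun := sumNorm X₀ X₁
  map_zero := le_antisymm ((sumNorm_le_left X₀ X₁ 0).trans X₀.nrm_zero.le) zero_le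
  eq_zero := eq_zero_of_sumNorm_eq_zero X₀ X₁
  smul_le := sumNorm_smul_le X₀ X₁
  add_le := sumNorm_add_le X₀ X₁

/-- An absolutely convergent series is split term by term, each decomposition optimal up to 2⁻ⁿ; the
two resulting series converge in X_0 and in X_1. -/
instance : CompleteSpace (sumExtNorm X₀ X₁).Space := by
  set N := sumExtNorm X₀ X₁ with hN
  refine NormedAddCommGroup.completeSpace_of_summable_imp_tendsto fun u hu => ?_
  have hu' : ∑' n, N.toFun (N.incl (u n)) ≠ ∞ := by
    simp_rw [← N.enorm_eq, ← ofReal_norm]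
    exact hu.tsum_ofReal_ne_top
  have hex : ∀ n : ℕ, ∃ a b, a + b = N.incl (u n) ∧
      X₀.nrm a + X₁.nrm b < N.toFun (N.incl (u n)) + (2⁻¹ : ℝ≥0∞) ^ n := fun n =>
    exists_of_sumNorm_lt X₀ X₁
      (ENNReal.lt_add_right (N.incl_lt_top (u n)).ne (ENNReal.pow_pos (by simp) n).ne')
  choose a b hab hlt using hex
  have hfin : ∑' n, (N.toFun (N.incl (u n)) + (2⁻¹ : ℝ≥0∞) ^ n) ≠ ∞ := by
    rw [ENNReal.tsum_add]
    exact ENNReal.add_ne_top.2 ⟨hu', tsum_half_pow⟩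
  obtain ⟨s, hs⟩ := X₀.exists_tendsto_sum a (ne_top_of_le_ne_top hfin
    (ENNReal.tsum_le_tsum fun n => le_self_add.trans (hlt n).le))
  obtain ⟨t, ht⟩ := X₁.exists_tendsto_sum b (ne_top_of_le_ne_top hfin
    (ENNReal.tsum_le_tsum fun n => le_add_self.trans (hlt n).le))
  have hlim : Tendsto (fun M => N.toFun (∑ n ∈ Finset.range M, N.incl (u n) - (s + t))) atTop
      (𝓝 0) := by
    have hst := hs.add ht
    rw [add_zero] at hst
    refine tendsto_of_tendsto_of_tendsto_of_le_of_le tendsto_const_nhds hst (fun _ => zero_le)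
      fun M => sumNorm_le_add X₀ X₁ ?_
    simp_rw [← hab, Finset.sum_add_distrib]
    abel
  have hst : N.toFun (s + t) < ∞ := by
    obtain ⟨M, hM⟩ := (hlim.eventually (gt_mem_nhds (show (0 : ℝ≥0∞) < 1 by simp))).exists
    have h1 : s + t = N.incl (∑ n ∈ Finset.range M, u n)
        - (∑ n ∈ Finset.range M, N.incl (u n) - (s + t)) := by
      rw [map_sum]
      abel
    rw [h1]
    exact N.sub_lt_top (N.incl_lt_top _) (hM.trans ENNReal.one_lt_top)
  refine ⟨N.lift (s + t), N.tendsto_iff.2 ?_⟩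
  simpa only [N.incl_lift hst, map_sum] using hlim

end

section

/-! ### The Calderón space -/

namespace ExtNorm

variable {V : Type*} [AddCommGroup V] [Module ℂ V] (N : ExtNorm V)

lemma tendsto_smul_sub {ι : Type*} {l : Filter ι} {c : ι → ℂ} {c₀ : ℂ} {v : ι → V} {v₀ : V}
    (hc : Tendsto c l (𝓝 c₀)) (hv : Tendsto (fun i => N.toFun (v i - v₀)) l (𝓝 0))
    (hfin : N.toFun v₀ < ∞) : Tendsto (fun i => N.toFun (c i • v i - c₀ • v₀)) l (𝓝 0) := by
  have h1 : Tendsto (fun i => ‖c i‖ₑ * N.toFun (v i - v₀) + ‖c i - c₀‖ₑ * N.toFun v₀) l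
      (𝓝 (‖c₀‖ₑ * 0 + 0 * N.toFun v₀)) := by
    refine (ENNReal.Tendsto.mul hc.enorm (Or.inr (by simp)) hv (Or.inr (by simp))).add
      (ENNReal.Tendsto.mul_const ?_ (Or.inr hfin.ne))
    have := (hc.sub_const c₀).enorm
    simpa using this
  rw [mul_zero, zero_mul, add_zero] at h1
  refine tendsto_of_tendsto_of_tendsto_of_le_of_le tendsto_const_nhds h1 (fun _ => zero_le)
    fun i => ?_
  have : c i • v i - c₀ • v₀ = c i • (v i - v₀) + (c i - c₀) • v₀ := by
    rw [smul_sub, sub_smul]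
    abel
  simp only [this]
  exact (N.add_le _ _).trans (add_le_add (N.smul_le _ _) (N.smul_le _ _))

end ExtNorm

/-- A bounded family of bounded multipliers on the closed strip, holomorphic with derivative `m'`
in the open strip, with uniform estimates. -/
structure IsMultiplier (m m' : ℂ → α →ₘ[μ] ℂ) (C : ℝ≥0) (δ : ℝ) : Prop where
  pos : 0 < δ
  bound : ∀ z ∈ closedStrip, ∀ᵐ ω ∂μ, ‖m z ω‖ ≤ C
  lipschitz : ∀ z ∈ closedStrip, ∀ w ∈ closedStrip, ‖w - z‖ < δ →
    ∀ᵐ ω ∂μ, ‖(m w - m z) ω‖ ≤ (C * ‖w - z‖₊ : ℝ≥0)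
  deriv : ∀ z ∈ closedStrip, ∀ w, ‖w - z‖ < δ →
    ∀ᵐ ω ∂μ, ‖(m w - m z - (w - z) • m' z) ω‖ ≤ (C * ‖w - z‖₊ ^ 2 : ℝ≥0)

lemma IsMultiplier.const {a : α →ₘ[μ] ℂ} {c : ℝ≥0} (ha : ∀ᵐ ω ∂μ, ‖a ω‖ ≤ c) :
    IsMultiplier (fun _ => a) (fun _ => 0) c 1 where
  pos := one_pos
  bound _ _ := ha
  lipschitz z _ w _ _ := by
    filter_upwards [AEEqFun.coeFn_zero (μ := μ) (β := ℂ) (α := α)] with ω h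
    rw [sub_self, h]
    simp only [Pi.zero_apply, norm_zero]
    positivity
  deriv z _ w _ := by
    have e : a - a - (w - z) • (0 : α →ₘ[μ] ℂ) = 0 := by
      rw [sub_self, zero_sub, neg_eq_zero]
      exact smul_zero (A := α →ₘ[μ] ℂ) (w - z)
    rw [e]
    filter_upwards [AEEqFun.coeFn_zero (μ := μ) (β := ℂ) (α := α)] with ω h
    rw [h]
    simp only [Pi.zero_apply, norm_zero]
    positivity

lemma strip_subset_closedStrip : strip ⊆ closedStrip := fun _ hz => ⟨hz.1.le, hz.2.le⟩

lemma isOpen_strip : IsOpen strip :=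
  (isOpen_lt continuous_const Complex.continuous_re).inter
    (isOpen_lt Complex.continuous_re continuous_const)

lemma left_mem (t : ℝ) : (t * Complex.I : ℂ) ∈ closedStrip := by
  simp [closedStrip]

lemma right_mem (t : ℝ) : (1 + t * Complex.I : ℂ) ∈ closedStrip := by
  simp [closedStrip]

lemma tendsto_left (t : ℝ) :
    Tendsto (fun s : ℝ => (s * Complex.I : ℂ)) (𝓝 t) (𝓝 (t * Complex.I)) :=
  Continuous.tendsto (by fun_prop) t

lemma tendsto_right (t : ℝ) :
    Tendsto (fun s : ℝ => (1 + s * Complex.I : ℂ)) (𝓝 t) (𝓝 (1 + t * Complex.I)) :=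
  Continuous.tendsto (f := fun s : ℝ => (1 + s * Complex.I : ℂ)) (by fun_prop) t

/-- The norm and the filter are kept general to cover all three continuity conditions of the
Calderón space: the sum norm on the closed strip and the two norms on the edges. -/
lemma IsMultiplier.tendsto_mul_sub {m m' : ℂ → α →ₘ[μ] ℂ} {C : ℝ≥0} {δ : ℝ}
    (hm : IsMultiplier m m' C δ) (N : ExtNorm (α →ₘ[μ] ℂ))
    (hN : ∀ (φ : α →ₘ[μ] ℂ) (c : ℝ≥0), (∀ᵐ ω ∂μ, ‖φ ω‖ ≤ c) →
      ∀ f, N.toFun (φ * f) ≤ c * N.toFun f)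
    {ι : Type*} {l : Filter ι} {a : ι → ℂ} {z : ℂ} (hz : z ∈ closedStrip)
    (ha : ∀ᶠ i in l, a i ∈ closedStrip) (hlim : Tendsto a l (𝓝 z)) {F : ℂ → α →ₘ[μ] ℂ}
    (hfin : N.toFun (F z) < ∞) (hF : Tendsto (fun i => N.toFun (F (a i) - F z)) l (𝓝 0)) :
    Tendsto (fun i => N.toFun (m (a i) * F (a i) - m z * F z)) l (𝓝 0) := by
  have hnn : Tendsto (fun i => ((C * ‖a i - z‖₊ : ℝ≥0) : ℝ≥0∞)) l (𝓝 0) := by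
    rw [← ENNReal.coe_zero, ENNReal.tendsto_coe]
    have := ((hlim.sub_const z).nnnorm).const_mul C
    simpa using this
  have h1 : Tendsto (fun i => C * N.toFun (F (a i) - F z)
      + (C * ‖a i - z‖₊ : ℝ≥0) * N.toFun (F z)) l (𝓝 (C * 0 + 0 * N.toFun (F z))) :=
    (ENNReal.Tendsto.const_mul hF (Or.inr (by simp))).add
      (ENNReal.Tendsto.mul_const hnn (Or.inr hfin.ne))
  rw [mul_zero, zero_mul, add_zero] at h1
  have hδ : ∀ᶠ i in l, ‖a i - z‖ < δ := by
    have := (hlim.sub_const z).norm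
    rw [sub_self, norm_zero] at this
    exact this.eventually (gt_mem_nhds hm.pos)
  refine tendsto_of_tendsto_of_tendsto_of_le_of_le' tendsto_const_nhds h1
    (Eventually.of_forall fun _ => zero_le) ?_
  filter_upwards [ha, hδ] with i hi hi'
  have : m (a i) * F (a i) - m z * F z = m (a i) * (F (a i) - F z) + (m (a i) - m z) * F z := by
    rw [mul_sub_fun, sub_mul_fun]
    abel
  rw [this]
  exact (N.add_le _ _).trans (add_le_add (hN _ _ (hm.bound _ hi) _)
    (hN _ _ (hm.lipschitz z hz _ hi hi') _))

variable {X₀ X₁} {F G : ℂ → α →ₘ[μ] ℂ}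

lemma InCalderon.lt_top (hF : InCalderon X₀ X₁ F) {z : ℂ} (hz : z ∈ closedStrip) :
    sumNorm X₀ X₁ (F z) < ∞ := by
  obtain ⟨M, hM⟩ := hF.bounded
  exact (hM z hz).trans_lt (by simp)

lemma InCalderon.left_lt_top (hF : InCalderon X₀ X₁ F) (t : ℝ) :
    X₀.nrm (F (t * Complex.I)) < ∞ := by
  obtain ⟨M, hM⟩ := hF.bounded_left
  exact (hM t).trans_lt (by simp)

lemma InCalderon.right_lt_top (hF : InCalderon X₀ X₁ F) (t : ℝ) :
    X₁.nrm (F (1 + t * Complex.I)) < ∞ := by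
  obtain ⟨M, hM⟩ := hF.bounded_right
  exact (hM t).trans_lt (by simp)

lemma calderonNorm_le_iff {M : ℝ≥0∞} : calderonNorm X₀ X₁ F ≤ M ↔
    (∀ t : ℝ, X₀.nrm (F (t * Complex.I)) ≤ M) ∧ ∀ t : ℝ, X₁.nrm (F (1 + t * Complex.I)) ≤ M := by
  simp only [calderonNorm, max_le_iff, iSup_le_iff]

lemma left_le_calderonNorm (F : ℂ → α →ₘ[μ] ℂ) (t : ℝ) :
    X₀.nrm (F (t * Complex.I)) ≤ calderonNorm X₀ X₁ F :=
  (calderonNorm_le_iff.1 le_rfl).1 t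

lemma right_le_calderonNorm (F : ℂ → α →ₘ[μ] ℂ) (t : ℝ) :
    X₁.nrm (F (1 + t * Complex.I)) ≤ calderonNorm X₀ X₁ F :=
  (calderonNorm_le_iff.1 le_rfl).2 t

lemma InCalderon.calderonNorm_lt_top (hF : InCalderon X₀ X₁ F) :
    calderonNorm X₀ X₁ F < ∞ := by
  obtain ⟨M, hM⟩ := hF.bounded_left
  obtain ⟨M', hM'⟩ := hF.bounded_right
  have : calderonNorm X₀ X₁ F ≤ (max M M' : ℝ≥0) := by
    rw [calderonNorm_le_iff]
    exact ⟨fun t => (hM t).trans (by simp), fun t => (hM' t).trans (by simp)⟩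
  exact this.trans_lt (by simp)

lemma HasDerivInSum.sub {z : ℂ} {d e : α →ₘ[μ] ℂ} (hF : HasDerivInSum X₀ X₁ F z d)
    (hG : HasDerivInSum X₀ X₁ G z e) : HasDerivInSum X₀ X₁ (F - G) z (d - e) := by
  have h := Tendsto.add hF hG
  rw [add_zero] at h
  refine tendsto_of_tendsto_of_tendsto_of_le_of_le tendsto_const_nhds h (fun _ => zero_le)
    fun w => ?_
  have : (w - z)⁻¹ • ((F - G) w - (F - G) z) - (d - e)
      = ((w - z)⁻¹ • (F w - F z) - d) - ((w - z)⁻¹ • (G w - G z) - e) := by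
    simp only [Pi.sub_apply, smul_sub]
    abel
  simp only [this]
  exact (sumExtNorm X₀ X₁).sub_le _ _

lemma InCalderon.sub (hF : InCalderon X₀ X₁ F) (hG : InCalderon X₀ X₁ G) :
    InCalderon X₀ X₁ (F - G) := by
  have key : ∀ (N : ExtNorm (α →ₘ[μ] ℂ)) {ι : Type} {l : Filter ι} {a : ι → ℂ} {z : ℂ},
      Tendsto (fun i => N.toFun (F (a i) - F z)) l (𝓝 0) →
      Tendsto (fun i => N.toFun (G (a i) - G z)) l (𝓝 0) →
      Tendsto (fun i => N.toFun ((F - G) (a i) - (F - G) z)) l (𝓝 0) := by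
    intro N ι l a z h1 h2
    have h := h1.add h2
    rw [add_zero] at h
    refine tendsto_of_tendsto_of_tendsto_of_le_of_le tendsto_const_nhds h (fun _ => zero_le)
      fun w => ?_
    simp only [Pi.sub_apply, sub_sub_sub_comm (F (a w)) (G (a w))]
    exact N.sub_le _ _
  refine ⟨?_, fun z hz => key (sumExtNorm X₀ X₁) (hF.continuousOn z hz) (hG.continuousOn z hz),
    fun z hz => ?_, ?_, fun t => key X₀.extNorm (hF.continuous_left t) (hG.continuous_left t), ?_,
    fun t => key X₁.extNorm (hF.continuous_right t) (hG.continuous_right t)⟩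
  · obtain ⟨M, hM⟩ := hF.bounded
    obtain ⟨M', hM'⟩ := hG.bounded
    refine ⟨M + M', fun z hz => ((sumExtNorm X₀ X₁).sub_le _ _).trans ?_⟩
    rw [ENNReal.coe_add]
    exact add_le_add (hM z hz) (hM' z hz)
  · obtain ⟨d, hd⟩ := hF.holomorphic z hz
    obtain ⟨e, he⟩ := hG.holomorphic z hz
    exact ⟨d - e, hd.sub he⟩
  · obtain ⟨M, hM⟩ := hF.bounded_left
    obtain ⟨M', hM'⟩ := hG.bounded_left
    refine ⟨M + M', fun t => (X₀.extNorm.sub_le _ _).trans ?_⟩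
    rw [ENNReal.coe_add]
    exact add_le_add (hM t) (hM' t)
  · obtain ⟨M, hM⟩ := hF.bounded_right
    obtain ⟨M', hM'⟩ := hG.bounded_right
    refine ⟨M + M', fun t => (X₁.extNorm.sub_le _ _).trans ?_⟩
    rw [ENNReal.coe_add]
    exact add_le_add (hM t) (hM' t)

lemma calderonNorm_sub_le (F G : ℂ → α →ₘ[μ] ℂ) :
    calderonNorm X₀ X₁ (F - G) ≤ calderonNorm X₀ X₁ F + calderonNorm X₀ X₁ G :=
  calderonNorm_le_iff.2 ⟨fun t => (X₀.extNorm.sub_le _ _).trans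
      (add_le_add (left_le_calderonNorm F t) (left_le_calderonNorm G t)),
    fun t => (X₁.extNorm.sub_le _ _).trans
      (add_le_add (right_le_calderonNorm F t) (right_le_calderonNorm G t))⟩

/-- A derivative is only asked to be an element of L_0, but some difference quotient of finite norm
lies within distance 1 of it. -/
lemma HasDerivInSum.sumNorm_lt_top {z : ℂ} {d : α →ₘ[μ] ℂ} (hd : HasDerivInSum X₀ X₁ F z d)
    (hF : ∀ᶠ w in 𝓝 z, sumNorm X₀ X₁ (F w) < ∞) : sumNorm X₀ X₁ d < ∞ := by
  obtain ⟨w, hw, hw'⟩ := ((Tendsto.eventually hd (gt_mem_nhds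
    (show (0 : ℝ≥0∞) < 1 by simp))).and (hF.filter_mono nhdsWithin_le_nhds)).exists
  have : d = (w - z)⁻¹ • (F w - F z) - ((w - z)⁻¹ • (F w - F z) - d) := by abel
  rw [this]
  exact (sumExtNorm X₀ X₁).sub_lt_top ((sumExtNorm X₀ X₁).smul_lt_top _
    ((sumExtNorm X₀ X₁).sub_lt_top hw' hF.self_of_nhds)) (hw.trans ENNReal.one_lt_top)

lemma InCalderon.eventually_lt_top (hF : InCalderon X₀ X₁ F) {z : ℂ} (hz : z ∈ strip) :
    ∀ᶠ w in 𝓝 z, sumNorm X₀ X₁ (F w) < ∞ := by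
  filter_upwards [isOpen_strip.mem_nhds hz] with w hw using hF.lt_top (strip_subset_closedStrip hw)

lemma HasDerivInSum.mul {m m' : ℂ → α →ₘ[μ] ℂ} {C : ℝ≥0} {δ : ℝ} (hm : IsMultiplier m m' C δ)
    {z : ℂ} (hz : z ∈ strip) {d : α →ₘ[μ] ℂ} (hd : HasDerivInSum X₀ X₁ F z d)
    (hF : ∀ᶠ w in 𝓝 z, sumNorm X₀ X₁ (F w) < ∞) :
    HasDerivInSum X₀ X₁ (m * F) z (m z * d + m' z * F z) := by
  have hdfin := hd.sumNorm_lt_top hF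
  have hFz : sumNorm X₀ X₁ (F z) < ∞ := hF.self_of_nhds
  have hz' := strip_subset_closedStrip hz
  have hid : Tendsto (fun w : ℂ => w) (𝓝[≠] z) (𝓝 z) := nhdsWithin_le_nhds
  have hnn : Tendsto (fun w => ((C * ‖w - z‖₊ : ℝ≥0) : ℝ≥0∞)) (𝓝[≠] z) (𝓝 0) := by
    rw [← ENNReal.coe_zero, ENNReal.tendsto_coe]
    have := ((hid.sub_const z).nnnorm).const_mul C
    simpa using this
  have h1 : Tendsto (fun w => C * sumNorm X₀ X₁ ((w - z)⁻¹ • (F w - F z) - d)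
      + (C * ‖w - z‖₊ : ℝ≥0) * sumNorm X₀ X₁ d + (C * ‖w - z‖₊ : ℝ≥0) * sumNorm X₀ X₁ (F z))
      (𝓝[≠] z) (𝓝 (C * 0 + 0 * sumNorm X₀ X₁ d + 0 * sumNorm X₀ X₁ (F z))) :=
    ((ENNReal.Tendsto.const_mul hd (Or.inr (by simp))).add
      (ENNReal.Tendsto.mul_const hnn (Or.inr hdfin.ne))).add
      (ENNReal.Tendsto.mul_const hnn (Or.inr hFz.ne))
  rw [mul_zero, zero_mul, zero_mul, add_zero, add_zero] at h1
  have hδ : ∀ᶠ w in 𝓝[≠] z, ‖w - z‖ < δ := by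
    have := (hid.sub_const z).norm
    rw [sub_self, norm_zero] at this
    exact this.eventually (gt_mem_nhds hm.pos)
  refine tendsto_of_tendsto_of_tendsto_of_le_of_le' tendsto_const_nhds h1
    (Eventually.of_forall fun _ => zero_le) ?_
  filter_upwards [hδ, self_mem_nhdsWithin,
    nhdsWithin_le_nhds (isOpen_strip.mem_nhds hz)] with w hw hne hws
  have hws' := strip_subset_closedStrip hws
  have hwz : w - z ≠ 0 := sub_ne_zero.2 hne
  -- The Leibniz error splits into the error of F, the variation of m acting on d, and the error of
  -- m acting on F z; the last two are O(|w - z|).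
  have hid : (w - z)⁻¹ • ((m * F) w - (m * F) z) - (m z * d + m' z * F z)
      = m w * ((w - z)⁻¹ • (F w - F z) - d) + (m w - m z) * d
        + ((w - z)⁻¹ • (m w - m z - (w - z) • m' z)) * F z := by
    simp only [Pi.mul_apply, mul_sub_fun, sub_mul_fun, smul_mul_fun, mul_smul_fun, smul_sub,
      inv_smul_smul₀ hwz]
    abel
  rw [hid]
  refine ((sumExtNorm X₀ X₁).add_le _ _).trans (add_le_add
    (((sumExtNorm X₀ X₁).add_le _ _).trans (add_le_add
      (sumNorm_mul_le X₀ X₁ (hm.bound w hws') _)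
      (sumNorm_mul_le X₀ X₁ (hm.lipschitz z hz' w hws' hw) _))) (sumNorm_mul_le X₀ X₁ ?_ _))
  filter_upwards [hm.deriv z hz' w hw,
    AEEqFun.coeFn_smul (w - z)⁻¹ (m w - m z - (w - z) • m' z)] with ω h2 h3
  rw [h3, Pi.smul_apply, norm_smul, norm_inv]
  have hpos : 0 < ‖w - z‖ := norm_pos_iff.2 hwz
  rw [inv_mul_le_iff₀ hpos]
  refine h2.trans_eq ?_
  push_cast
  ring

lemma InCalderon.mul {m m' : ℂ → α →ₘ[μ] ℂ} {C : ℝ≥0} {δ : ℝ} (hm : IsMultiplier m m' C δ)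
    (hF : InCalderon X₀ X₁ F) : InCalderon X₀ X₁ (m * F) := by
  refine ⟨?_, fun z hz => hm.tendsto_mul_sub (sumExtNorm X₀ X₁)
      (fun φ c h f => sumNorm_mul_le X₀ X₁ h f) hz self_mem_nhdsWithin nhdsWithin_le_nhds
      (hF.lt_top hz) (hF.continuousOn z hz),
    fun z hz => ?_, ?_, fun t => hm.tendsto_mul_sub X₀.extNorm (fun φ c h f => X₀.nrm_mul_le h f)
      (left_mem t) (Eventually.of_forall left_mem) (tendsto_left t) (hF.left_lt_top t)
      (hF.continuous_left t), ?_,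
    fun t => hm.tendsto_mul_sub X₁.extNorm (fun φ c h f => X₁.nrm_mul_le h f)
      (right_mem t) (Eventually.of_forall right_mem) (tendsto_right t) (hF.right_lt_top t)
      (hF.continuous_right t)⟩
  · obtain ⟨M, hM⟩ := hF.bounded
    refine ⟨C * M, fun z hz => (sumNorm_mul_le X₀ X₁ (hm.bound z hz) _).trans ?_⟩
    rw [ENNReal.coe_mul]
    gcongr
    exact hM z hz
  · obtain ⟨d, hd⟩ := hF.holomorphic z hz
    exact ⟨_, hd.mul hm hz (hF.eventually_lt_top hz)⟩
  · obtain ⟨M, hM⟩ := hF.bounded_left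
    refine ⟨C * M, fun t => (X₀.nrm_mul_le (hm.bound _ (left_mem t)) _).trans ?_⟩
    rw [ENNReal.coe_mul]
    gcongr
    exact hM t
  · obtain ⟨M, hM⟩ := hF.bounded_right
    refine ⟨C * M, fun t => (X₁.nrm_mul_le (hm.bound _ (right_mem t)) _).trans ?_⟩
    rw [ENNReal.coe_mul]
    gcongr
    exact hM t

lemma hasDerivInSum_const (u : α →ₘ[μ] ℂ) (z : ℂ) :
    HasDerivInSum X₀ X₁ (fun _ => u) z 0 := by
  have : sumNorm X₀ X₁ 0 = 0 := (sumExtNorm X₀ X₁).map_zero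
  simp [HasDerivInSum, this]

lemma inCalderon_const {u : α →ₘ[μ] ℂ} (h₀ : X₀.nrm u < ∞) (h₁ : X₁.nrm u < ∞) :
    InCalderon X₀ X₁ fun _ => u := by
  have : sumNorm X₀ X₁ 0 = 0 := (sumExtNorm X₀ X₁).map_zero
  refine ⟨⟨(X₀.nrm u).toNNReal, fun z _ => ?_⟩, fun z _ => by simpa [this] using tendsto_const_nhds,
    fun z _ => ⟨0, hasDerivInSum_const u z⟩,
    ⟨(X₀.nrm u).toNNReal, fun t => ?_⟩, fun t => by simp [X₀.nrm_zero],
    ⟨(X₁.nrm u).toNNReal, fun t => ?_⟩, fun t => by simp [X₁.nrm_zero]⟩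
  · rw [ENNReal.coe_toNNReal h₀.ne]
    exact sumNorm_le_left X₀ X₁ u
  · rw [ENNReal.coe_toNNReal h₀.ne]
  · rw [ENNReal.coe_toNNReal h₁.ne]

/-! ### Functions with values in the Banach space `X_0 + X_1` -/

/-- A function with values in `L_0`, as a function with values in the Banach space
`X_0 + X_1`. -/
def sumLift (X₀ X₁ : KotheSpace μ) (F : ℂ → α →ₘ[μ] ℂ) (z : ℂ) : (sumExtNorm X₀ X₁).Space :=
  (sumExtNorm X₀ X₁).lift (F z)

lemma InCalderon.incl_sumLift (hF : InCalderon X₀ X₁ F) {z : ℂ} (hz : z ∈ closedStrip) :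
    (sumExtNorm X₀ X₁).incl (sumLift X₀ X₁ F z) = F z :=
  (sumExtNorm X₀ X₁).incl_lift (hF.lt_top hz)

lemma InCalderon.continuousOn_sumLift (hF : InCalderon X₀ X₁ F) :
    ContinuousOn (sumLift X₀ X₁ F) closedStrip := fun z hz => by
  refine (sumExtNorm X₀ X₁).tendsto_iff.2 ?_
  refine (hF.continuousOn z hz).congr' ?_
  filter_upwards [self_mem_nhdsWithin] with w hw
  rw [hF.incl_sumLift hz, hF.incl_sumLift hw]
  rfl

lemma InCalderon.hasDerivInSum_iff (hF : InCalderon X₀ X₁ F) {z : ℂ} (hz : z ∈ strip)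
    (d : (sumExtNorm X₀ X₁).Space) :
    HasDerivInSum X₀ X₁ F z ((sumExtNorm X₀ X₁).incl d) ↔ HasDerivAt (sumLift X₀ X₁ F) d z := by
  rw [hasDerivAt_iff_tendsto_slope, (sumExtNorm X₀ X₁).tendsto_iff]
  refine tendsto_congr' ?_
  filter_upwards [nhdsWithin_le_nhds (isOpen_strip.mem_nhds hz)] with w hw
  rw [slope_def_module, map_smul, map_sub, hF.incl_sumLift (strip_subset_closedStrip hz),
    hF.incl_sumLift (strip_subset_closedStrip hw)]
  rfl

lemma InCalderon.hasDerivAt_sumLift (hF : InCalderon X₀ X₁ F) {z : ℂ} (hz : z ∈ strip)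
    {d : α →ₘ[μ] ℂ} (hd : HasDerivInSum X₀ X₁ F z d) :
    HasDerivAt (sumLift X₀ X₁ F) ((sumExtNorm X₀ X₁).lift d) z := by
  rw [← hF.hasDerivInSum_iff hz, (sumExtNorm X₀ X₁).incl_lift
    (hd.sumNorm_lt_top (hF.eventually_lt_top hz))]
  exact hd

lemma InCalderon.differentiableOn_sumLift (hF : InCalderon X₀ X₁ F) :
    DifferentiableOn ℂ (sumLift X₀ X₁ F) strip := fun z hz => by
  obtain ⟨d, hd⟩ := hF.holomorphic z hz
  exact (hF.hasDerivAt_sumLift hz hd).differentiableAt.differentiableWithinAt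

end

section

/-! ### The interpolation norm -/

variable {X₀ X₁ : KotheSpace μ} {F G : ℂ → α →ₘ[μ] ℂ} {θ : ℝ}

lemma interpNorm_le (hF : InCalderon X₀ X₁ F) {x : α →ₘ[μ] ℂ} (hx : F θ = x) :
    interpNorm X₀ X₁ θ x ≤ calderonNorm X₀ X₁ F :=
  (iInf_le _ F).trans ((iInf_le _ hF).trans (iInf_le _ hx))

lemma exists_of_interpNorm_lt {x : α →ₘ[μ] ℂ} {r : ℝ≥0∞} (h : interpNorm X₀ X₁ θ x < r) :
    ∃ F, InCalderon X₀ X₁ F ∧ F θ = x ∧ calderonNorm X₀ X₁ F < r := by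
  simp only [interpNorm, iInf_lt_iff] at h
  obtain ⟨F, hF, hx, hlt⟩ := h
  exact ⟨F, hF, hx, hlt⟩

lemma interpNorm_zero : interpNorm X₀ X₁ θ 0 = 0 := by
  refine le_antisymm ((interpNorm_le (inCalderon_const (u := 0) ?_ ?_) rfl).trans ?_) zero_le
  · simp [X₀.nrm_zero]
  · simp [X₁.nrm_zero]
  · rw [calderonNorm_le_iff]
    simp [X₀.nrm_zero, X₁.nrm_zero]

lemma calderonNorm_mul_le {a : α →ₘ[μ] ℂ} {c : ℝ≥0} (ha : ∀ᵐ ω ∂μ, ‖a ω‖ ≤ c)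
    (F : ℂ → α →ₘ[μ] ℂ) :
    calderonNorm X₀ X₁ ((fun _ => a) * F) ≤ c * calderonNorm X₀ X₁ F :=
  calderonNorm_le_iff.2 ⟨fun t => (X₀.nrm_mul_le ha _).trans
      (by gcongr; exact left_le_calderonNorm F t),
    fun t => (X₁.nrm_mul_le ha _).trans (by gcongr; exact right_le_calderonNorm F t)⟩

lemma interpNorm_mul_le {a : α →ₘ[μ] ℂ} {c : ℝ≥0} (ha : ∀ᵐ ω ∂μ, ‖a ω‖ ≤ c) (x : α →ₘ[μ] ℂ) :
    interpNorm X₀ X₁ θ (a * x) ≤ c * interpNorm X₀ X₁ θ x := by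
  rcases eq_or_ne c 0 with rfl | hc
  · rw [mul_eq_zero_of_norm_le_zero ha, interpNorm_zero]
    exact zero_le
  conv_rhs => rw [interpNorm]
  simp_rw [ENNReal.mul_iInf_of_ne (show (c : ℝ≥0∞) ≠ 0 by simpa using hc) ENNReal.coe_ne_top]
  refine le_iInf fun F => le_iInf fun hF => le_iInf fun hx => ?_
  refine (interpNorm_le (hF.mul (IsMultiplier.const ha)) ?_).trans (calderonNorm_mul_le ha F)
  rw [Pi.mul_apply, hx]

lemma interpNorm_sub_le (x y : α →ₘ[μ] ℂ) :
    interpNorm X₀ X₁ θ (x - y) ≤ interpNorm X₀ X₁ θ x + interpNorm X₀ X₁ θ y := by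
  conv_rhs => rw [interpNorm, interpNorm]
  simp_rw [ENNReal.iInf_add, ENNReal.add_iInf]
  refine le_iInf fun F => le_iInf fun hF => le_iInf fun hx => le_iInf fun G => le_iInf fun hG =>
    le_iInf fun hy => ?_
  refine (interpNorm_le (hF.sub hG) ?_).trans (calderonNorm_sub_le F G)
  rw [Pi.sub_apply, hx, hy]

lemma ae_norm_neg_one : ∀ᵐ ω ∂μ, ‖(-1 : α →ₘ[μ] ℂ) ω‖ ≤ (1 : ℝ≥0) := by
  filter_upwards [AEEqFun.coeFn_neg (1 : α →ₘ[μ] ℂ),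
    AEEqFun.coeFn_one (μ := μ) (β := ℂ) (α := α)] with ω h1 h2
  rw [h1, Pi.neg_apply, h2]
  simp

lemma zero_mul_fun (f : α →ₘ[μ] ℂ) : 0 * f = 0 := by
  have h := sub_mul_fun 0 0 f
  rwa [sub_self, sub_self] at h

lemma neg_one_mul_fun (f : α →ₘ[μ] ℂ) : (-1) * f = -f := by
  rw [← zero_sub (1 : α →ₘ[μ] ℂ), sub_mul_fun, zero_mul_fun, one_mul, zero_sub]

lemma interpNorm_add_le (x y : α →ₘ[μ] ℂ) :
    interpNorm X₀ X₁ θ (x + y) ≤ interpNorm X₀ X₁ θ x + interpNorm X₀ X₁ θ y := by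
  have h : x + y = x - (-1) * y := by rw [neg_one_mul_fun, sub_neg_eq_add]
  rw [h]
  refine (interpNorm_sub_le _ _).trans ?_
  gcongr
  simpa using interpNorm_mul_le ae_norm_neg_one y

lemma theta_mem (hθ₀ : 0 < θ) (hθ₁ : θ < 1) : (θ : ℂ) ∈ strip := by
  simp [strip, hθ₀, hθ₁]

/-- The constant in `interpNorm_deriv_le`. -/
def derivConst (θ : ℝ) : ℝ≥0 := (max θ⁻¹ (1 - θ)⁻¹).toNNReal

lemma nnnorm_inv_left_le (hθ₀ : 0 < θ) (t : ℝ) : ‖(t * Complex.I - θ : ℂ)⁻¹‖₊ ≤ derivConst θ := by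
  rw [derivConst, ← norm_toNNReal]
  refine Real.toNNReal_le_toNNReal (le_trans ?_ (le_max_left _ _))
  rw [norm_inv]
  refine inv_anti₀ hθ₀ ?_
  have := Complex.abs_re_le_norm (t * Complex.I - θ : ℂ)
  simp only [Complex.sub_re, Complex.mul_re, Complex.ofReal_re, Complex.I_re, mul_zero,
    Complex.ofReal_im, Complex.I_im, mul_one, sub_self, zero_sub, abs_neg] at this
  exact (le_abs_self θ).trans this

lemma nnnorm_inv_right_le (hθ₁ : θ < 1) (t : ℝ) :
    ‖(1 + t * Complex.I - θ : ℂ)⁻¹‖₊ ≤ derivConst θ := by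
  rw [derivConst, ← norm_toNNReal]
  refine Real.toNNReal_le_toNNReal (le_trans ?_ (le_max_right _ _))
  rw [norm_inv]
  refine inv_anti₀ (by linarith) ?_
  have := Complex.abs_re_le_norm (1 + t * Complex.I - θ : ℂ)
  simp only [Complex.sub_re, Complex.add_re, Complex.one_re, Complex.mul_re, Complex.ofReal_re,
    Complex.I_re, mul_zero, Complex.ofReal_im, Complex.I_im, mul_one, sub_self, add_zero] at this
  exact (le_abs_self _).trans this

/-- If `F` in the Calderón space vanishes at `θ`, then `F'(θ)` lies in the interpolation space. -/
theorem interpNorm_deriv_le (hθ₀ : 0 < θ) (hθ₁ : θ < 1) (hF : InCalderon X₀ X₁ F)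
    (h0 : F θ = 0) {d : α →ₘ[μ] ℂ} (hd : HasDerivInSum X₀ X₁ F θ d) :
    interpNorm X₀ X₁ θ d ≤ derivConst θ * calderonNorm X₀ X₁ F := by
  have hθ := theta_mem hθ₀ hθ₁
  have hθc := strip_subset_closedStrip hθ
  have hnhds : strip ∈ 𝓝 (θ : ℂ) := isOpen_strip.mem_nhds hθ
  set N := sumExtNorm X₀ X₁ with hN
  set f := sumLift X₀ X₁ F with hf
  have hfd := hF.hasDerivAt_sumLift hθ hd
  have hcont : ContinuousOn (dslope f θ) closedStrip :=
    (continuousOn_dslope (mem_of_superset hnhds strip_subset_closedStrip)).2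
      ⟨hF.continuousOn_sumLift, hfd.differentiableAt⟩
  have hdiff : DifferentiableOn ℂ (dslope f θ) strip :=
    (Complex.differentiableOn_dslope hnhds).2 hF.differentiableOn_sumLift
  -- This is F(z)/(z - θ) with the removable singularity filled by F'(θ). On the edges |z - θ| is at
  -- least θ or 1 - θ, which is where `derivConst` comes from.
  set G : ℂ → α →ₘ[μ] ℂ := fun z => N.incl (dslope f θ z) with hG
  have hGθ : G θ = d := by
    change N.incl (dslope f θ θ) = d
    rw [dslope_same, hfd.deriv]
    exact N.incl_lift (hd.sumNorm_lt_top (hF.eventually_lt_top hθ))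
  have hGz : ∀ z ∈ closedStrip, z ≠ θ → G z = (z - θ)⁻¹ • F z := fun z hz hne => by
    simp only [hG]
    rw [dslope_of_ne _ hne, slope_def_module, map_smul, map_sub, hF.incl_sumLift hz,
      hF.incl_sumLift hθc, h0, sub_zero]
  have hl : ∀ t : ℝ, (t * Complex.I : ℂ) ≠ θ := fun t h => by
    have := congrArg Complex.re h
    simp at this
    exact hθ₀.ne this
  have hr : ∀ t : ℝ, (1 + t * Complex.I : ℂ) ≠ θ := fun t h => by
    have := congrArg Complex.re h
    simp at this
    exact hθ₁.ne' this
  have hleft : ∀ t : ℝ, X₀.nrm (G (t * Complex.I)) ≤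
      derivConst θ * calderonNorm X₀ X₁ F := fun t => by
    rw [hGz _ (left_mem t) (hl t), X₀.nrm_smul]
    refine mul_le_mul' ?_ (left_le_calderonNorm F t)
    rw [enorm_eq_nnnorm]
    exact_mod_cast nnnorm_inv_left_le hθ₀ t
  have hright : ∀ t : ℝ, X₁.nrm (G (1 + t * Complex.I)) ≤
      derivConst θ * calderonNorm X₀ X₁ F := fun t => by
    rw [hGz _ (right_mem t) (hr t), X₁.nrm_smul]
    refine mul_le_mul' ?_ (right_le_calderonNorm F t)
    rw [enorm_eq_nnnorm]
    exact_mod_cast nnnorm_inv_right_le hθ₁ t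
  have hfin : derivConst θ * calderonNorm X₀ X₁ F < ∞ :=
    ENNReal.mul_lt_top (by simp) hF.calderonNorm_lt_top
  -- Continuity bounds G near θ; at distance at least r from θ the factor (z - θ)⁻¹ is at most r⁻¹.
  have hbd : ∃ M : ℝ≥0, ∀ z ∈ closedStrip, sumNorm X₀ X₁ (G z) ≤ M := by
    have hc : ContinuousAt (dslope f θ) θ := continuousAt_dslope_same.2 hfd.differentiableAt
    obtain ⟨r, hr, hball⟩ := Metric.eventually_nhds_iff.1
      (hc.nnnorm.eventually (gt_mem_nhds (lt_add_one ‖dslope f θ θ‖₊)))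
    obtain ⟨M, hM⟩ := hF.bounded
    refine ⟨max (‖dslope f θ θ‖₊ + 1) (r⁻¹.toNNReal * M), fun z hz => ?_⟩
    by_cases hzr : dist z θ < r
    · have : sumNorm X₀ X₁ (G z) = ‖dslope f θ z‖ₑ := (N.enorm_eq _).symm
      rw [this, enorm_eq_nnnorm]
      exact_mod_cast (hball hzr).le.trans (le_max_left _ _)
    · have hne : z ≠ θ := by
        rintro rfl
        simp [hr] at hzr
      rw [hGz z hz hne]
      refine (sumNorm_smul_le X₀ X₁ _ _).trans ((mul_le_mul' ?_ (hM z hz)).trans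
        (show ((r⁻¹.toNNReal : ℝ≥0) : ℝ≥0∞) * M ≤ _ from ?_))
      · rw [enorm_eq_nnnorm, ← norm_toNNReal]
        refine ENNReal.coe_le_coe.2 (Real.toNNReal_le_toNNReal ?_)
        rw [norm_inv, ← dist_eq_norm]
        exact inv_anti₀ hr (not_lt.1 hzr)
      · exact_mod_cast le_max_right _ _
  have hGcal : InCalderon X₀ X₁ G := by
    refine ⟨hbd, fun z hz => N.tendsto_iff.1 (hcont z hz), fun z hz => ?_,
      ⟨(derivConst θ * calderonNorm X₀ X₁ F).toNNReal, fun t => ?_⟩, fun t => ?_,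
      ⟨(derivConst θ * calderonNorm X₀ X₁ F).toNNReal, fun t => ?_⟩, fun t => ?_⟩
    · have h1 := ((hdiff z hz).differentiableAt (isOpen_strip.mem_nhds hz)).hasDerivAt
      rw [hasDerivAt_iff_tendsto_slope, N.tendsto_iff] at h1
      refine ⟨N.incl (deriv (dslope f θ) z), h1.congr fun w => ?_⟩
      rw [slope_def_module, map_smul, map_sub]
      rfl
    · rw [ENNReal.coe_toNNReal hfin.ne]
      exact hleft t
    · simp_rw [hGz _ (left_mem _) (hl _)]
      exact X₀.extNorm.tendsto_smul_sub
        (((tendsto_left t).sub_const _).inv₀ (sub_ne_zero.2 (hl t)))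
        (hF.continuous_left t) (hF.left_lt_top t)
    · rw [ENNReal.coe_toNNReal hfin.ne]
      exact hright t
    · simp_rw [hGz _ (right_mem _) (hr _)]
      exact X₁.extNorm.tendsto_smul_sub
        (((tendsto_right t).sub_const _).inv₀ (sub_ne_zero.2 (hr t)))
        (hF.continuous_right t) (hF.right_lt_top t)
  exact (interpNorm_le hGcal hGθ).trans (calderonNorm_le_iff.2 ⟨hleft, hright⟩)

/-! ### Differentials are centralizers -/

variable {Ω : (α →ₘ[μ] ℂ) → (α →ₘ[μ] ℂ)}

/-- A differential is determined up to a bounded map: any other holomorphic function through `x`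
has nearly the same derivative. -/
theorem IsDifferential.exists_interpNorm_sub_le (hθ₀ : 0 < θ) (hθ₁ : θ < 1)
    (hΩ : IsDifferential X₀ X₁ θ Ω) : ∃ C : ℝ≥0, ∀ F d, InCalderon X₀ X₁ F →
      HasDerivInSum X₀ X₁ F θ d →
      interpNorm X₀ X₁ θ (Ω (F θ) - d) ≤ C * calderonNorm X₀ X₁ F := by
  obtain ⟨B, K, hB, -⟩ := hΩ
  refine ⟨derivConst θ * (K + 1), fun F d hF hd => ?_⟩
  have hle : interpNorm X₀ X₁ θ (F θ) ≤ calderonNorm X₀ X₁ F := interpNorm_le hF rfl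
  obtain ⟨h1, h2, h3, h4⟩ := hB (F θ) (hle.trans_lt hF.calderonNorm_lt_top)
  -- The selection at F θ and F itself agree at θ, so their difference vanishes there. Its Calderón
  -- norm is at most K + 1 times that of F.
  refine (interpNorm_deriv_le hθ₀ hθ₁ (h1.sub hF) ?_ (h4.sub hd)).trans ?_
  · rw [Pi.sub_apply, h2, sub_self]
  · push_cast
    rw [mul_assoc]
    gcongr
    refine (calderonNorm_sub_le _ _).trans ?_
    rw [add_mul, one_mul]
    gcongr
    exact h3.trans (by gcongr)

/-- A differential is a centralizer. -/
theorem IsDifferential.exists_interpNorm_commutator_le (hθ₀ : 0 < θ) (hθ₁ : θ < 1)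
    (hΩ : IsDifferential X₀ X₁ θ Ω) : ∃ C : ℝ≥0, ∀ (a x : α →ₘ[μ] ℂ) (c : ℝ≥0),
      (∀ᵐ ω ∂μ, ‖a ω‖ ≤ c) → interpNorm X₀ X₁ θ x < ∞ →
      interpNorm X₀ X₁ θ (Ω (a * x) - a * Ω x) ≤ C * c * interpNorm X₀ X₁ θ x := by
  obtain ⟨C, hC⟩ := hΩ.exists_interpNorm_sub_le hθ₀ hθ₁
  obtain ⟨B, K, hB, -⟩ := hΩ
  refine ⟨C * K, fun a x c ha hx => ?_⟩
  obtain ⟨h1, h2, h3, h4⟩ := hB x hx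
  have hm := IsMultiplier.const ha
  have hθ := theta_mem hθ₀ hθ₁
  -- The product of a with the selection at x is a competing Calderón function through a x, with
  -- derivative a Ω(x).
  have h := hC _ _ (h1.mul hm) (h4.mul hm hθ (h1.eventually_lt_top hθ))
  rw [zero_mul_fun, add_zero, Pi.mul_apply, h2] at h
  refine h.trans ?_
  calc (C : ℝ≥0∞) * calderonNorm X₀ X₁ ((fun _ => a) * B x)
      ≤ C * (c * (K * interpNorm X₀ X₁ θ x)) := by
        gcongr
        exact (calderonNorm_mul_le ha _).trans (by gcongr)
    _ = _ := by
        push_cast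
        ring

end

section

/-! ### Duality -/

variable {X₀ X₁ : KotheSpace μ} {F G : ℂ → α →ₘ[μ] ℂ} {θ : ℝ}
  {ρ : (α →ₘ[μ] ℂ) → ℝ≥0∞}

/-- This allows a norm, possibly zero, to be replaced by a slightly larger positive real, by which
one can divide or below which an infimum is nearly attained. -/
lemma le_mul_of_forall_lt {a b c : ℝ≥0∞} (hb : b ≠ ∞) (hc : c ≠ ∞)
    (h : ∀ r : ℝ≥0, b < r → a ≤ r * c) : a ≤ b * c := by
  have hlim : Tendsto (fun ε : ℝ≥0 => ((b.toNNReal + ε : ℝ≥0) : ℝ≥0∞) * c) (𝓝[>] 0)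
      (𝓝 (((b.toNNReal + 0 : ℝ≥0) : ℝ≥0∞) * c)) := by
    refine ENNReal.Tendsto.mul_const (ENNReal.tendsto_coe.2 ?_) (Or.inr hc)
    exact tendsto_const_nhds.add nhdsWithin_le_nhds
  rw [add_zero, ENNReal.coe_toNNReal hb] at hlim
  refine ge_of_tendsto hlim ?_
  filter_upwards [self_mem_nhdsWithin] with ε hε
  refine h _ ?_
  rw [ENNReal.coe_add, ENNReal.coe_toNNReal hb]
  exact ENNReal.lt_add_right hb (by simpa using (ne_of_gt hε))

lemma l1Norm_mono {f g : α →ₘ[μ] ℂ} (h : ∀ᵐ ω ∂μ, ‖f ω‖ ≤ ‖g ω‖) : l1Norm f ≤ l1Norm g := by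
  refine lintegral_mono_ae ?_
  filter_upwards [h] with ω hω using enorm_le_iff_norm_le.2 hω

lemma l1Norm_add_le (f g : α →ₘ[μ] ℂ) : l1Norm (f + g) ≤ l1Norm f + l1Norm g := by
  rw [l1Norm, l1Norm, l1Norm, ← lintegral_add_left' f.aestronglyMeasurable.enorm]
  refine lintegral_mono_ae ?_
  filter_upwards [AEEqFun.coeFn_add f g] with ω h
  rw [h]
  exact enorm_add_le _ _

lemma l1Norm_smul (c : ℂ) (f : α →ₘ[μ] ℂ) : l1Norm (c • f) = ‖c‖ₑ * l1Norm f := by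
  rw [l1Norm, l1Norm, ← lintegral_const_mul' _ _ (by simp)]
  refine lintegral_congr_ae ?_
  filter_upwards [AEEqFun.coeFn_smul c f] with ω h
  rw [h, Pi.smul_apply, enorm_smul]

lemma norm_mul_le_mul_of_le (f : α →ₘ[μ] ℂ) {g h : α →ₘ[μ] ℂ}
    (hgh : ∀ᵐ ω ∂μ, ‖g ω‖ ≤ ‖h ω‖) : ∀ᵐ ω ∂μ, ‖(f * g) ω‖ ≤ ‖(f * h) ω‖ := by
  filter_upwards [AEEqFun.coeFn_mul f g, AEEqFun.coeFn_mul f h, hgh] with ω h1 h2 h3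
  rw [h1, h2, Pi.mul_apply, Pi.mul_apply, norm_mul, norm_mul]
  gcongr

lemma kotheDual_mono {g h : α →ₘ[μ] ℂ} (hgh : ∀ᵐ ω ∂μ, ‖g ω‖ ≤ ‖h ω‖) :
    kotheDual ρ g ≤ kotheDual ρ h :=
  iSup_mono fun f => iSup_mono fun _ => l1Norm_mono (norm_mul_le_mul_of_le f hgh)

/-- Hölder's inequality for the Köthe dual. -/
lemma l1Norm_mul_le_kotheDual (hρ : ∀ (c : ℂ) f, ρ (c • f) ≤ ‖c‖ₑ * ρ f) {f g : α →ₘ[μ] ℂ}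
    (hf : ρ f < ∞) (hg : kotheDual ρ g < ∞) : l1Norm (f * g) ≤ ρ f * kotheDual ρ g := by
  refine le_mul_of_forall_lt hf.ne hg.ne fun r hr => ?_
  have hr0 : r ≠ 0 := by
    rintro rfl
    simp at hr
  have hc : ‖((r : ℝ) : ℂ)⁻¹‖ₑ = (r : ℝ≥0∞)⁻¹ := by
    rw [enorm_eq_nnnorm, nnnorm_inv, ENNReal.coe_inv (by simpa using hr0)]
    simp
  have h1 : ρ (((r : ℝ) : ℂ)⁻¹ • f) ≤ 1 := by
    refine (hρ _ _).trans ?_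
    rw [hc]
    calc (r : ℝ≥0∞)⁻¹ * ρ f ≤ (r : ℝ≥0∞)⁻¹ * r := by gcongr
      _ = 1 := ENNReal.inv_mul_cancel (by simpa using hr0) (by simp)
  have h2 : l1Norm ((((r : ℝ) : ℂ)⁻¹ • f) * g) ≤ kotheDual ρ g :=
    le_iSup₂ (f := fun (f : α →ₘ[μ] ℂ) (_ : ρ f ≤ 1) => l1Norm (f * g)) _ h1
  rw [smul_mul_fun, l1Norm_smul, hc] at h2
  calc l1Norm (f * g) = r * ((r : ℝ≥0∞)⁻¹ * l1Norm (f * g)) := by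
        rw [← mul_assoc, ENNReal.mul_inv_cancel (by simpa using hr0) (by simp), one_mul]
    _ ≤ _ := by gcongr

lemma l1Norm_mul_le_nrm (X : KotheSpace μ) {f g : α →ₘ[μ] ℂ}
    (hf : X.nrm f < ∞) (hg : kotheDual X.nrm g < ∞) :
    l1Norm (f * g) ≤ X.nrm f * kotheDual X.nrm g :=
  l1Norm_mul_le_kotheDual (fun c f => (X.nrm_smul c f).le) hf hg

lemma ae_norm_smul_one (c : ℂ) : ∀ᵐ ω ∂μ, ‖(c • (1 : α →ₘ[μ] ℂ)) ω‖ ≤ ‖c‖₊ := by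
  filter_upwards [AEEqFun.coeFn_smul c (1 : α →ₘ[μ] ℂ),
    AEEqFun.coeFn_one (μ := μ) (β := ℂ) (α := α)] with ω h1 h2
  simp [h1, h2]

lemma interpNorm_smul_le (c : ℂ) (f : α →ₘ[μ] ℂ) :
    interpNorm X₀ X₁ θ (c • f) ≤ ‖c‖ₑ * interpNorm X₀ X₁ θ f := by
  have h : c • f = (c • (1 : α →ₘ[μ] ℂ)) * f := by rw [smul_mul_fun, one_mul]
  rw [h, enorm_eq_nnnorm]
  exact interpNorm_mul_le (ae_norm_smul_one c) f

lemma l1Norm_mul_le_interpNorm {f g : α →ₘ[μ] ℂ} (hf : interpNorm X₀ X₁ θ f < ∞)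
    (hg : kotheDual (interpNorm X₀ X₁ θ) g < ∞) :
    l1Norm (f * g) ≤ interpNorm X₀ X₁ θ f * kotheDual (interpNorm X₀ X₁ θ) g :=
  l1Norm_mul_le_kotheDual interpNorm_smul_le hf hg

/-! ### The multipliers `exp ((z - θ) l)` -/

/-- The multiplier `exp ((z - θ) l)`. -/
def expMult (μ : Measure α) (θ : ℝ) {l : α → ℝ} (hl : Measurable l) (z : ℂ) : α →ₘ[μ] ℂ :=
  ofFun (fun ω => Complex.exp ((z - θ) * l ω)) (by fun_prop)

/-- The derivative of the multiplier `exp ((z - θ) l)`. -/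
def expMultDeriv (μ : Measure α) (θ : ℝ) {l : α → ℝ} (hl : Measurable l) (z : ℂ) : α →ₘ[μ] ℂ :=
  ofFun (fun ω => l ω * Complex.exp ((z - θ) * l ω)) (by fun_prop)

lemma coeFn_expMult {l : α → ℝ} (hl : Measurable l) (z : ℂ) :
    expMult μ θ hl z =ᵐ[μ] fun ω => Complex.exp ((z - θ) * l ω) :=
  coeFn_ofFun _ _

lemma norm_exp_mul_real (z : ℂ) (x : ℝ) :
    ‖Complex.exp ((z - θ) * x)‖ = Real.exp ((z.re - θ) * x) := by
  rw [Complex.norm_exp]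
  simp

lemma ae_norm_expMult {l : α → ℝ} (hl : Measurable l) (z : ℂ) :
    ∀ᵐ ω ∂μ, ‖expMult μ θ hl z ω‖ = Real.exp ((z.re - θ) * l ω) := by
  filter_upwards [coeFn_expMult (θ := θ) hl z] with ω h
  rw [h, norm_exp_mul_real]

lemma norm_exp_mul_real_le (hθ₀ : 0 < θ) (hθ₁ : θ < 1) {z : ℂ} (hz : z ∈ closedStrip) {x n : ℝ}
    (hx : |x| ≤ n) : ‖Complex.exp ((z - θ) * x)‖ ≤ Real.exp n := by
  rw [norm_exp_mul_real, Real.exp_le_exp]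
  have h1 : |z.re - θ| ≤ 1 := abs_le.2 ⟨by linarith [hz.1], by linarith [hz.2]⟩
  calc (z.re - θ) * x ≤ |z.re - θ| * |x| := by rw [← abs_mul]; exact le_abs_self _
    _ ≤ 1 * n := by gcongr
    _ = n := one_mul n

/-- The three summands 1, 2n and n² serve the sup bound, the Lipschitz bound and the second-order
bound. The radius (n + 1)⁻¹ keeps |(w - z)l| ≤ 1, where |e^v - 1| ≤ 2|v| and |e^v - 1 - v| ≤ |v|².
-/
lemma isMultiplier_expMult (hθ₀ : 0 < θ) (hθ₁ : θ < 1) {l : α → ℝ} (hl : Measurable l) {n : ℝ}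
    (hn : ∀ ω, |l ω| ≤ n) (hn0 : 0 ≤ n) : IsMultiplier (expMult μ θ hl) (expMultDeriv μ θ hl)
      (Real.exp n * (1 + 2 * n + n ^ 2)).toNNReal (n + 1)⁻¹ := by
  have hC : ((Real.exp n * (1 + 2 * n + n ^ 2)).toNNReal : ℝ) =
      Real.exp n * (1 + 2 * n + n ^ 2) := Real.coe_toNNReal _ (by positivity)
  have hadd : ∀ (z w : ℂ) (x : ℝ), Complex.exp ((w - θ) * x)
      = Complex.exp ((z - θ) * x) * Complex.exp ((w - z) * x) := fun z w x => by
    rw [← Complex.exp_add]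
    ring_nf
  have hux : ∀ (u : ℂ) (ω : α), ‖u * l ω‖ ≤ n * ‖u‖ := fun u ω => by
    rw [norm_mul, Complex.norm_real, mul_comm]
    gcongr
    exact hn ω
  have hsmall : ∀ (u : ℂ) (ω : α), ‖u‖ < (n + 1)⁻¹ → ‖u * l ω‖ ≤ 1 := fun u ω hu => by
    refine (hux u ω).trans ?_
    calc n * ‖u‖ ≤ (n + 1) * (n + 1)⁻¹ := by gcongr; linarith
      _ = 1 := mul_inv_cancel₀ (by positivity)
  refine ⟨by positivity, fun z hz => ?_, fun z hz w _ hw => ?_, fun z hz w hw => ?_⟩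
  · filter_upwards [coeFn_expMult (θ := θ) hl z] with ω h1
    rw [h1, hC]
    refine (norm_exp_mul_real_le hθ₀ hθ₁ hz (hn ω)).trans ?_
    exact le_mul_of_one_le_right (Real.exp_pos n).le (by nlinarith)
  · filter_upwards [coeFn_expMult (θ := θ) hl z, coeFn_expMult (θ := θ) hl w,
      AEEqFun.coeFn_sub (expMult μ θ hl w) (expMult μ θ hl z)] with ω h1 h2 h3
    rw [h3, Pi.sub_apply, h1, h2, hadd z w, ← mul_sub_one, norm_mul, NNReal.coe_mul, hC,
      coe_nnnorm, mul_assoc]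
    refine mul_le_mul (norm_exp_mul_real_le hθ₀ hθ₁ hz (hn ω)) ?_ (norm_nonneg _)
      (Real.exp_pos n).le
    refine (Complex.norm_exp_sub_one_le (hsmall _ ω hw)).trans ?_
    have := hux (w - z) ω
    nlinarith [norm_nonneg (w - z), mul_nonneg (sq_nonneg n) (norm_nonneg (w - z))]
  · filter_upwards [coeFn_expMult (θ := θ) hl z, coeFn_expMult (θ := θ) hl w,
      coeFn_ofFun (μ := μ) (fun ω => l ω * Complex.exp ((z - θ) * l ω)) (by fun_prop),
      AEEqFun.coeFn_sub (expMult μ θ hl w) (expMult μ θ hl z),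
      AEEqFun.coeFn_sub (expMult μ θ hl w - expMult μ θ hl z) ((w - z) • expMultDeriv μ θ hl z),
      AEEqFun.coeFn_smul (w - z) (expMultDeriv μ θ hl z)] with ω h1 h2 h3 h4 h5 h6
    have h7 : expMultDeriv μ θ hl z ω = l ω * Complex.exp ((z - θ) * l ω) := h3
    rw [h5, Pi.sub_apply, h4, h6, Pi.sub_apply, Pi.smul_apply, h7, h1, h2, hadd z w]
    have : Complex.exp ((z - θ) * l ω) * Complex.exp ((w - z) * l ω)
        - Complex.exp ((z - θ) * l ω) - (w - z) • (l ω * Complex.exp ((z - θ) * l ω))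
        = Complex.exp ((z - θ) * l ω) *
          (Complex.exp ((w - z) * l ω) - 1 - (w - z) * l ω) := by
      rw [smul_eq_mul]
      ring
    rw [this, norm_mul, NNReal.coe_mul, hC, NNReal.coe_pow, coe_nnnorm, mul_assoc]
    refine mul_le_mul (norm_exp_mul_real_le hθ₀ hθ₁ hz (hn ω)) ?_ (norm_nonneg _)
      (Real.exp_pos n).le
    refine (Complex.norm_exp_sub_one_sub_id_le (hsmall _ ω hw)).trans ?_
    have h8 : ‖(w - z) * l ω‖ ^ 2 ≤ (n * ‖w - z‖) ^ 2 := by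
      gcongr
      exact hux (w - z) ω
    nlinarith [sq_nonneg ‖w - z‖, mul_nonneg hn0 (sq_nonneg ‖w - z‖)]

lemma ae_norm_expMult_left {l : α → ℝ} (hl : Measurable l) (t : ℝ) :
    ∀ᵐ ω ∂μ, ‖expMult μ θ hl (t * Complex.I) ω‖ = ‖expMult μ θ hl 0 ω‖ := by
  filter_upwards [ae_norm_expMult (μ := μ) (θ := θ) hl (t * Complex.I),
    ae_norm_expMult (μ := μ) (θ := θ) hl 0] with ω h1 h2
  rw [h1, h2]
  simp

lemma ae_norm_expMult_right {l : α → ℝ} (hl : Measurable l) (t : ℝ) :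
    ∀ᵐ ω ∂μ, ‖expMult μ θ hl (1 + t * Complex.I) ω‖ = ‖expMult μ θ hl 1 ω‖ := by
  filter_upwards [ae_norm_expMult (μ := μ) (θ := θ) hl (1 + t * Complex.I),
    ae_norm_expMult (μ := μ) (θ := θ) hl 1] with ω h1 h2
  rw [h1, h2]
  simp

lemma expMult_theta {l : α → ℝ} (hl : Measurable l) : expMult μ θ hl θ = 1 := by
  apply AEEqFun.ext
  filter_upwards [coeFn_expMult (μ := μ) (θ := θ) hl θ,
    AEEqFun.coeFn_one (μ := μ) (β := ℂ) (α := α)] with ω h1 h2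
  rw [h1, h2]
  simp

/-- The weight in the multiplier is bounded below on the closed strip. -/
lemma ae_norm_le_expMult_mul (hθ₀ : 0 < θ) (hθ₁ : θ < 1) {l : α → ℝ} (hl : Measurable l) {n : ℝ}
    (hn : ∀ ω, |l ω| ≤ n) {z : ℂ} (hz : z ∈ closedStrip) (g : α →ₘ[μ] ℂ) :
    ∀ᵐ ω ∂μ, ‖g ω‖ ≤ ‖(((Real.exp n : ℝ) : ℂ) • (expMult μ θ hl z * g)) ω‖ := by
  filter_upwards [coeFn_expMult (μ := μ) (θ := θ) hl z, AEEqFun.coeFn_mul (expMult μ θ hl z) g,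
    AEEqFun.coeFn_smul ((Real.exp n : ℝ) : ℂ) (expMult μ θ hl z * g)] with ω h1 h2 h3
  rw [h3, Pi.smul_apply, h2, Pi.mul_apply, h1, norm_smul, norm_mul, Complex.norm_real,
    Real.norm_of_nonneg (Real.exp_pos n).le, ← mul_assoc]
  refine le_mul_of_one_le_left (norm_nonneg _) ?_
  have h4 : ‖Complex.exp ((z - θ) * (-l ω : ℝ))‖ ≤ Real.exp n :=
    norm_exp_mul_real_le hθ₀ hθ₁ hz (by rw [abs_neg]; exact hn ω)
  rw [norm_exp_mul_real] at h4 ⊢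
  calc (1 : ℝ) = Real.exp ((z.re - θ) * -l ω) * Real.exp ((z.re - θ) * l ω) := by
        rw [← Real.exp_add]
        simp
    _ ≤ _ := by gcongr

end

section

/-! ### The Köthe dual of the interpolation space -/

variable {X₀ X₁ : KotheSpace μ} {θ : ℝ}

lemma l1Norm_mul_le_sumNorm {g : α →ₘ[μ] ℂ} {D : ℝ≥0}
    (h₀ : ∀ a, X₀.nrm a < ∞ → l1Norm (a * g) ≤ X₀.nrm a * D)
    (h₁ : ∀ a, X₁.nrm a < ∞ → l1Norm (a * g) ≤ X₁.nrm a * D) {v : α →ₘ[μ] ℂ}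
    (hv : sumNorm X₀ X₁ v < ∞) : l1Norm (v * g) ≤ sumNorm X₀ X₁ v * D := by
  refine le_mul_of_forall_lt hv.ne (by simp) fun r hr => ?_
  obtain ⟨a, b, rfl, hlt⟩ := exists_of_sumNorm_lt X₀ X₁ hr
  have ha : X₀.nrm a < ∞ := (le_self_add.trans_lt hlt).trans (by simp)
  have hb : X₁.nrm b < ∞ := (le_add_self.trans_lt hlt).trans (by simp)
  rw [add_mul_fun]
  calc l1Norm (a * g + b * g) ≤ X₀.nrm a * D + X₁.nrm b * D :=
        (l1Norm_add_le _ _).trans (add_le_add (h₀ a ha) (h₁ b hb))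
    _ = (X₀.nrm a + X₁.nrm b) * D := by ring
    _ ≤ r * D := by gcongr

lemma integrable_of_l1Norm_lt_top {f : α →ₘ[μ] ℂ} (hf : l1Norm f < ∞) : Integrable f μ :=
  ⟨f.aestronglyMeasurable, hf⟩

/-- Integration against a function, as a functional on `X_0 + X_1`. -/
def integralFunctional (X₀ X₁ : KotheSpace μ) (g : α →ₘ[μ] ℂ) (D : ℝ≥0)
    (h : ∀ v, sumNorm X₀ X₁ v < ∞ → l1Norm (v * g) ≤ sumNorm X₀ X₁ v * D) :
    (sumExtNorm X₀ X₁).Space →L[ℂ] ℂ :=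
  LinearMap.mkContinuous
    { toFun := fun v => ∫ ω, ((sumExtNorm X₀ X₁).incl v * g) ω ∂μ
      map_add' := fun v w => by
        have hi : ∀ v, Integrable ((sumExtNorm X₀ X₁).incl v * g : α →ₘ[μ] ℂ) μ := fun v =>
          integrable_of_l1Norm_lt_top ((h _ ((sumExtNorm X₀ X₁).incl_lt_top v)).trans_lt
            (ENNReal.mul_lt_top ((sumExtNorm X₀ X₁).incl_lt_top v) (by simp)))
        rw [← integral_add (hi v) (hi w), map_add, add_mul_fun]
        exact integral_congr_ae (AEEqFun.coeFn_add _ _)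
      map_smul' := fun c v => by
        rw [map_smul, smul_mul_fun, RingHom.id_apply, ← integral_smul]
        exact integral_congr_ae (AEEqFun.coeFn_smul _ _) } D fun v => by
    have h1 := h _ ((sumExtNorm X₀ X₁).incl_lt_top v)
    have h2 : ‖∫ ω, ((sumExtNorm X₀ X₁).incl v * g) ω ∂μ‖ₑ ≤ ‖v‖ₑ * D :=
      (enorm_integral_le_lintegral_enorm _).trans (h1.trans_eq (by
        rw [(sumExtNorm X₀ X₁).enorm_eq]
        rfl))
    have h3 := ENNReal.toReal_mono (ENNReal.mul_lt_top (by simp) (by simp)).ne h2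
    rw [ENNReal.toReal_mul] at h3
    simp only [toReal_enorm, ENNReal.coe_toReal] at h3
    rw [mul_comm]
    exact h3

lemma integralFunctional_apply {g : α →ₘ[μ] ℂ} {D : ℝ≥0}
    (h : ∀ v, sumNorm X₀ X₁ v < ∞ → l1Norm (v * g) ≤ sumNorm X₀ X₁ v * D)
    (v : (sumExtNorm X₀ X₁).Space) : integralFunctional X₀ X₁ g D h v =
      ∫ ω, ((sumExtNorm X₀ X₁).incl v * g) ω ∂μ := rfl

/-- The three lines theorem for a functional on the Calderón space. -/
lemma norm_integral_le_of_boundary (hθ₀ : 0 < θ) (hθ₁ : θ < 1) {H : ℂ → α →ₘ[μ] ℂ}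
    (hH : InCalderon X₀ X₁ H) {g : α →ₘ[μ] ℂ} {D : ℝ≥0}
    (h : ∀ v, sumNorm X₀ X₁ v < ∞ → l1Norm (v * g) ≤ sumNorm X₀ X₁ v * D) {M : ℝ≥0}
    (hl : ∀ t : ℝ, l1Norm (H (t * Complex.I) * g) ≤ M)
    (hr : ∀ t : ℝ, l1Norm (H (1 + t * Complex.I) * g) ≤ M) :
    ‖∫ ω, (H θ * g) ω ∂μ‖ ≤ M := by
  set Φ := integralFunctional X₀ X₁ g D h with hΦ
  have hval : ∀ z ∈ closedStrip, Φ (sumLift X₀ X₁ H z) = ∫ ω, (H z * g) ω ∂μ := fun z hz => by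
    rw [hΦ, integralFunctional_apply, hH.incl_sumLift hz]
  have hbd : ∀ z ∈ closedStrip, l1Norm (H z * g) ≤ M →
      ‖Φ (sumLift X₀ X₁ H z)‖ ≤ M := fun z hz hle => by
    rw [hval z hz]
    have h2 := ENNReal.toReal_mono (by simp)
      ((enorm_integral_le_lintegral_enorm fun ω => (H z * g) ω).trans hle)
    simpa using h2
  rw [← hval θ (strip_subset_closedStrip (theta_mem hθ₀ hθ₁))]
  have hs : Complex.re ⁻¹' Set.Ioo 0 1 = strip := rfl
  have hclosed : IsClosed closedStrip :=
    (isClosed_le continuous_const Complex.continuous_re).inter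
      (isClosed_le Complex.continuous_re continuous_const)
  -- The constant D only makes the functional bounded, hence the scalar function bounded in the
  -- strip; both growth parameters can then be 0. The final bound sees the edges alone.
  refine PhragmenLindelof.vertical_strip (a := 0) (b := 1)
    (f := fun z => Φ (sumLift X₀ X₁ H z)) ⟨?_, ?_⟩ ⟨0, by simpa using Real.pi_pos, 0, ?_⟩
    (fun z hz => ?_) (fun z hz => ?_) (by simpa using hθ₀.le) (by simpa using hθ₁.le)
  · rw [hs]
    exact Φ.differentiable.comp_differentiableOn hH.differentiableOn_sumLift
  · rw [hs]
    exact (Φ.continuous.comp_continuousOn hH.continuousOn_sumLift).mono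
      (closure_minimal strip_subset_closedStrip hclosed)
  · obtain ⟨B, hB⟩ := hH.bounded
    refine Asymptotics.IsBigO.of_bound (‖Φ‖ * B) ?_
    filter_upwards [mem_inf_of_right (mem_principal_self _)] with z hz
    have hz' := strip_subset_closedStrip (hs ▸ hz)
    simp only [zero_mul, Real.exp_zero, norm_one, mul_one]
    refine (Φ.le_opNorm _).trans ?_
    gcongr
    have h1 : ‖sumLift X₀ X₁ H z‖ₑ ≤ B := by
      rw [(sumExtNorm X₀ X₁).enorm_eq, hH.incl_sumLift hz']
      exact hB z hz'
    simpa using ENNReal.toReal_mono (by simp) h1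
  · have : z = z.im * Complex.I := by
      apply Complex.ext <;> simp [hz]
    rw [this]
    exact hbd _ (left_mem _) (hl _)
  · have : z = 1 + z.im * Complex.I := by
      apply Complex.ext <;> simp [hz]
    rw [this]
    exact hbd _ (right_mem _) (hr _)

/-- The phase factor that turns a function into its modulus. -/
def phase (f : α →ₘ[μ] ℂ) : α →ₘ[μ] ℂ :=
  ofFun (fun ω => ((‖f ω‖ : ℝ) : ℂ) / f ω) (by
    have := f.measurable
    fun_prop)

lemma coeFn_phase (f : α →ₘ[μ] ℂ) : phase f =ᵐ[μ] fun ω => ((‖f ω‖ : ℝ) : ℂ) / f ω :=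
  coeFn_ofFun _ _

lemma ae_norm_phase_le (f : α →ₘ[μ] ℂ) : ∀ᵐ ω ∂μ, ‖phase f ω‖ ≤ (1 : ℝ≥0) := by
  filter_upwards [coeFn_phase f] with ω h
  rw [h, norm_div, Complex.norm_real, norm_norm]
  exact div_self_le_one _

lemma phase_mul (f : α →ₘ[μ] ℂ) : phase f * f = modulus f := by
  apply AEEqFun.ext
  filter_upwards [coeFn_phase f, AEEqFun.coeFn_mul (phase f) f, coeFn_modulus f] with ω h1 h2 h3
  rw [h2, h3, Pi.mul_apply, h1]
  rcases eq_or_ne (f ω) 0 with h | h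
  · simp [h]
  · exact div_mul_cancel₀ _ h

lemma l1Norm_mul_mul_le {φ : α →ₘ[μ] ℂ} (hφ : ∀ᵐ ω ∂μ, ‖φ ω‖ ≤ (1 : ℝ≥0)) (f g : α →ₘ[μ] ℂ) :
    l1Norm (f * (φ * g)) ≤ l1Norm (f * g) := by
  refine l1Norm_mono (norm_mul_le_mul_of_le f ?_)
  filter_upwards [hφ, AEEqFun.coeFn_mul φ g] with ω h1 h2
  rw [h2, Pi.mul_apply, norm_mul]
  exact mul_le_of_le_one_left (norm_nonneg _) (by simpa using h1)

/-- A criterion for membership in the Köthe dual of the interpolation space. -/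
theorem kotheDual_interpNorm_le (hθ₀ : 0 < θ) (hθ₁ : θ < 1) {l : α → ℝ} (hl : Measurable l)
    {n : ℝ} (hn : ∀ ω, |l ω| ≤ n) (hn0 : 0 ≤ n) {g : α →ₘ[μ] ℂ} {M : ℝ≥0}
    (h₀ : kotheDual X₀.nrm (expMult μ θ hl 0 * g) ≤ M)
    (h₁ : kotheDual X₁.nrm (expMult μ θ hl 1 * g) ≤ M) :
    kotheDual (interpNorm X₀ X₁ θ) g ≤ M := by
  have hm := isMultiplier_expMult (μ := μ) hθ₀ hθ₁ hl hn hn0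
  have hM : (M : ℝ≥0∞) < ∞ := by simp
  -- As l is bounded, g itself pairs with X_0 and X_1. The factor exp n serves only to define the
  -- functional on the sum and is absent from the conclusion.
  have key : ∀ (X : KotheSpace μ) (z : ℂ), z ∈ closedStrip →
      kotheDual X.nrm (expMult μ θ hl z * g) ≤ M → ∀ a, X.nrm a < ∞ →
      l1Norm (a * g) ≤ X.nrm a * ((Real.exp n).toNNReal * M : ℝ≥0) := by
    intro X z hz hX a ha
    refine (l1Norm_mono (norm_mul_le_mul_of_le a (ae_norm_le_expMult_mul hθ₀ hθ₁ hl hn hz g))).trans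
      ?_
    rw [mul_smul_fun, l1Norm_smul]
    refine (mul_le_mul' le_rfl (l1Norm_mul_le_nrm X ha (hX.trans_lt hM))).trans ?_
    have he : ‖((Real.exp n : ℝ) : ℂ)‖ₑ = (Real.exp n).toNNReal := by
      rw [enorm_eq_nnnorm, ← norm_toNNReal, Complex.norm_real,
        Real.norm_of_nonneg (Real.exp_pos n).le]
    rw [he, ENNReal.coe_mul, mul_left_comm]
    gcongr
  have hsum : ∀ v, sumNorm X₀ X₁ v < ∞ →
      l1Norm (v * g) ≤ sumNorm X₀ X₁ v * ((Real.exp n).toNNReal * M : ℝ≥0) := fun v hv =>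
    l1Norm_mul_le_sumNorm (key X₀ 0 (by simp [closedStrip]) h₀)
      (key X₁ 1 (by simp [closedStrip]) h₁) hv
  refine iSup₂_le fun y hy => ?_
  rw [← one_mul (M : ℝ≥0∞)]
  refine le_mul_of_forall_lt (by simp) hM.ne fun r hr => ?_
  obtain ⟨F, hF, rfl, hFr⟩ := exists_of_interpNorm_lt (hy.trans_lt hr)
  -- With this phase the pairing at θ is the integral of |F θ * g|, so a bound on one integral
  -- bounds the L_1 norm.
  set s := phase (F θ * g) with hs
  have hs1 := ae_norm_phase_le (F θ * g)
  have hboundary : ∀ (X : KotheSpace μ) (z z' : ℂ), (∀ᵐ ω ∂μ, ‖expMult μ θ hl z ω‖ =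
      ‖expMult μ θ hl z' ω‖) → X.nrm (F z) ≤ r →
      kotheDual X.nrm (expMult μ θ hl z' * g) ≤ M →
      l1Norm ((expMult μ θ hl * F) z * (s * g)) ≤ (r * M : ℝ≥0) := by
    intro X z z' hzz hFz hX
    refine (l1Norm_mul_mul_le hs1 _ _).trans ?_
    rw [Pi.mul_apply, mul_comm (expMult μ θ hl z), mul_assoc]
    have hle : ∀ᵐ ω ∂μ, ‖(expMult μ θ hl z * g) ω‖ ≤ ‖(expMult μ θ hl z' * g) ω‖ := by
      filter_upwards [AEEqFun.coeFn_mul (expMult μ θ hl z) g,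
        AEEqFun.coeFn_mul (expMult μ θ hl z') g, hzz] with ω h1 h2 h3
      rw [h1, h2, Pi.mul_apply, Pi.mul_apply, norm_mul, norm_mul, h3]
    refine (l1Norm_mono (norm_mul_le_mul_of_le _ hle)).trans
      ((l1Norm_mul_le_nrm X (hFz.trans_lt (by simp)) (hX.trans_lt hM)).trans ?_)
    rw [ENNReal.coe_mul]
    gcongr
  have hint := norm_integral_le_of_boundary hθ₀ hθ₁ (hF.mul hm)
    (g := s * g) (D := (Real.exp n).toNNReal * M)
    (fun v hv => (l1Norm_mul_mul_le hs1 v g).trans (hsum v hv)) (M := r * M)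
    (fun t => hboundary X₀ _ 0 (ae_norm_expMult_left hl t)
      ((left_le_calderonNorm F t).trans hFr.le) h₀)
    (fun t => hboundary X₁ _ 1 (ae_norm_expMult_right hl t)
      ((right_le_calderonNorm F t).trans hFr.le) h₁)
  have hmod : (expMult μ θ hl * F) θ * (s * g) = modulus (F θ * g) := by
    rw [Pi.mul_apply, expMult_theta, one_mul, mul_left_comm, hs, phase_mul]
  have hfin : l1Norm (F θ * g) < ∞ :=
    (hsum _ (hF.lt_top (strip_subset_closedStrip (theta_mem hθ₀ hθ₁)))).trans_lt
      (ENNReal.mul_lt_top (hF.lt_top (strip_subset_closedStrip (theta_mem hθ₀ hθ₁)))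
        ENNReal.coe_lt_top)
  have heq : ∫ ω, modulus (F θ * g) ω ∂μ = ((∫ ω, ‖(F θ * g) ω‖ ∂μ : ℝ) : ℂ) := 
    (integral_congr_ae (coeFn_modulus _)).trans integral_ofReal
  rw [hmod, heq, Complex.norm_real, Real.norm_of_nonneg (integral_nonneg fun _ => norm_nonneg _),
    integral_norm_eq_lintegral_enorm (AEEqFun.aestronglyMeasurable _)] at hint
  have := (ENNReal.toReal_le_toReal hfin.ne (b := ((r * M : ℝ≥0) : ℝ≥0∞))
    ENNReal.coe_ne_top).1 (hint.trans_eq (ENNReal.coe_toReal _).symm)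
  rwa [ENNReal.coe_mul] at this

/-! ### Independence of the factorization -/

/-- The pointwise quotient of two functions. -/
def ratio (x w : α →ₘ[μ] ℂ) : α →ₘ[μ] ℂ :=
  ofFun (fun ω => x ω / w ω) (x.measurable.div w.measurable)

lemma coeFn_ratio (x w : α →ₘ[μ] ℂ) : ratio x w =ᵐ[μ] fun ω => x ω / w ω := coeFn_ofFun _ _

/-- Where w vanishes so does x, by the domination, and the value 0 of the quotient there is
harmless. -/
lemma ratio_mul_of_le {x w : α →ₘ[μ] ℂ} {c : ℝ}
    (h : ∀ᵐ ω ∂μ, ‖x ω‖ ≤ c * ‖w ω‖) : ratio x w * w = x := by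
  apply AEEqFun.ext
  filter_upwards [h, AEEqFun.coeFn_mul (ratio x w) w, coeFn_ratio x w] with ω h1 h2 h3
  rw [h2, Pi.mul_apply, h3]
  rcases eq_or_ne (w ω) 0 with h | h
  · simp only [h, norm_zero, mul_zero] at h1 ⊢
    exact (norm_le_zero_iff.1 h1).symm
  · exact div_mul_cancel₀ _ h

lemma ae_norm_ratio_le {x w : α →ₘ[μ] ℂ} {c : ℝ≥0}
    (h : ∀ᵐ ω ∂μ, ‖x ω‖ ≤ c * ‖w ω‖) : ∀ᵐ ω ∂μ, ‖ratio x w ω‖ ≤ c := by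
  filter_upwards [h, coeFn_ratio x w] with ω h1 h3
  rw [h3, norm_div]
  exact div_le_of_le_mul₀ (norm_nonneg _) c.coe_nonneg h1

lemma interpNorm_modulus_le (x : α →ₘ[μ] ℂ) :
    interpNorm X₀ X₁ θ (modulus x) ≤ interpNorm X₀ X₁ θ x := by
  rw [← phase_mul]
  simpa using interpNorm_mul_le (ae_norm_phase_le x) x

variable {Ω : (α →ₘ[μ] ℂ) → (α →ₘ[μ] ℂ)}

/-- Writing x = aw with a bounded, the centralizer property moves a from the argument of Ω onto the
dual factor. -/
lemma l1Norm_transfer_le {C : ℝ≥0} (hC : ∀ (a x : α →ₘ[μ] ℂ) (c : ℝ≥0),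
      (∀ᵐ ω ∂μ, ‖a ω‖ ≤ c) → interpNorm X₀ X₁ θ x < ∞ →
      interpNorm X₀ X₁ θ (Ω (a * x) - a * Ω x) ≤ C * c * interpNorm X₀ X₁ θ x)
    {x w xs : α →ₘ[μ] ℂ} {c : ℝ≥0} (h : ∀ᵐ ω ∂μ, ‖x ω‖ ≤ c * ‖w ω‖)
    (hw : interpNorm X₀ X₁ θ w < ∞) (hxs : kotheDual (interpNorm X₀ X₁ θ) xs < ∞) :
    l1Norm (Ω x * xs - Ω w * (ratio x w * xs)) ≤
      C * c * interpNorm X₀ X₁ θ w * kotheDual (interpNorm X₀ X₁ θ) xs := by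
  have h1 := hC (ratio x w) w c (ae_norm_ratio_le h) hw
  rw [ratio_mul_of_le h] at h1
  have h2 : Ω x * xs - Ω w * (ratio x w * xs) = (Ω x - ratio x w * Ω w) * xs := by
    rw [sub_mul_fun, mul_left_comm, mul_assoc]
  rw [h2]
  refine (l1Norm_mul_le_interpNorm (h1.trans_lt ?_) hxs).trans (by gcongr)
  exact ENNReal.mul_lt_top (ENNReal.mul_lt_top (by simp) (by simp)) hw

/-- For a centralizer, `Ω(x) x^*` depends only on `x x^*`, up to a bounded map. -/
theorem l1Norm_factorization_sub_le {C : ℝ≥0} (hC : ∀ (a x : α →ₘ[μ] ℂ) (c : ℝ≥0),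
      (∀ᵐ ω ∂μ, ‖a ω‖ ≤ c) → interpNorm X₀ X₁ θ x < ∞ →
      interpNorm X₀ X₁ θ (Ω (a * x) - a * Ω x) ≤ C * c * interpNorm X₀ X₁ θ x)
    {x xs y ys : α →ₘ[μ] ℂ} (h : x * xs = y * ys)
    (hx : interpNorm X₀ X₁ θ x < ∞) (hxs : kotheDual (interpNorm X₀ X₁ θ) xs < ∞)
    (hy : interpNorm X₀ X₁ θ y < ∞) (hys : kotheDual (interpNorm X₀ X₁ θ) ys < ∞) :
    l1Norm (Ω x * xs - Ω y * ys) ≤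
      2 * C * (interpNorm X₀ X₁ θ x * kotheDual (interpNorm X₀ X₁ θ) xs
        + interpNorm X₀ X₁ θ y * kotheDual (interpNorm X₀ X₁ θ) ys) := by
  set ρ := interpNorm X₀ X₁ θ with hρ
  -- The strict bounds p and q are positive even if a norm is zero. Weighting |x| by 1/p and |y| by
  -- 1/q in w keeps its norm at most 2 and yields no cross products such as ‖x‖‖y^*‖.
  have main : ∀ p q : ℝ≥0, ρ x < p → ρ y < q → l1Norm (Ω x * xs - Ω y * ys) ≤
      2 * C * (p * kotheDual ρ xs + q * kotheDual ρ ys) := by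
    intro p q hp hq
    have hp0 : p ≠ 0 := by
      rintro rfl
      simp at hp
    have hq0 : q ≠ 0 := by
      rintro rfl
      simp at hq
    set cp : ℂ := (((p⁻¹ : ℝ≥0) : ℝ) : ℂ) with hcp
    set cq : ℂ := (((q⁻¹ : ℝ≥0) : ℝ) : ℂ) with hcq
    set w : α →ₘ[μ] ℂ := cp • modulus x + cq • modulus y with hw
    have hwω : ∀ᵐ ω ∂μ, ‖w ω‖ = (p : ℝ)⁻¹ * ‖x ω‖ + (q : ℝ)⁻¹ * ‖y ω‖ := by
      filter_upwards [AEEqFun.coeFn_add (cp • modulus x) (cq • modulus y),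
        AEEqFun.coeFn_smul cp (modulus x), AEEqFun.coeFn_smul cq (modulus y),
        coeFn_modulus x, coeFn_modulus y] with ω h1 h2 h3 h4 h5
      rw [hw, h1, Pi.add_apply, h2, h3, Pi.smul_apply, Pi.smul_apply, h4, h5, smul_eq_mul,
        smul_eq_mul, hcp, hcq, ← Complex.ofReal_mul, ← Complex.ofReal_mul, ← Complex.ofReal_add,
        Complex.norm_real, Real.norm_of_nonneg (by positivity)]
      push_cast
      rfl
    have hxw : ∀ᵐ ω ∂μ, ‖x ω‖ ≤ p * ‖w ω‖ := by
      filter_upwards [hwω] with ω h1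
      have hp' : (p : ℝ) ≠ 0 := by exact_mod_cast hp0
      rw [h1, mul_add, mul_inv_cancel_left₀ hp']
      exact le_add_of_nonneg_right (by positivity)
    have hyw : ∀ᵐ ω ∂μ, ‖y ω‖ ≤ q * ‖w ω‖ := by
      filter_upwards [hwω] with ω h1
      have hq' : (q : ℝ) ≠ 0 := by exact_mod_cast hq0
      rw [h1, mul_add, mul_inv_cancel_left₀ hq']
      exact le_add_of_nonneg_left (by positivity)
    have hscale : ∀ (v : α →ₘ[μ] ℂ) (r : ℝ≥0), r ≠ 0 → ρ v < r →
        ρ ((((r⁻¹ : ℝ≥0) : ℝ) : ℂ) • modulus v) ≤ 1 := by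
      intro v r hr0 hr
      refine (interpNorm_smul_le _ _).trans ?_
      have he : ‖(((r⁻¹ : ℝ≥0) : ℝ) : ℂ)‖ₑ = (r⁻¹ : ℝ≥0) := by
        rw [enorm_eq_nnnorm]
        simp
      rw [he]
      calc ((r⁻¹ : ℝ≥0) : ℝ≥0∞) * ρ (modulus v) ≤ (r⁻¹ : ℝ≥0) * r := by
            gcongr
            exact (interpNorm_modulus_le v).trans hr.le
        _ = 1 := by
            rw [← ENNReal.coe_mul, inv_mul_cancel₀ hr0, ENNReal.coe_one]
    have hρw : ρ w ≤ 2 := by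
      refine (interpNorm_add_le _ _).trans ?_
      rw [← one_add_one_eq_two]
      exact add_le_add (hscale x p hp0 hp) (hscale y q hq0 hq)
    -- Both factorizations are transferred to Ω w times the same function, so the transferred terms
    -- cancel.
    have hws : ratio x w * xs = ratio y w * ys := by
      apply AEEqFun.ext
      have h' : (x * xs : α →ₘ[μ] ℂ) =ᵐ[μ] (y * ys : α →ₘ[μ] ℂ) := by rw [h]
      filter_upwards [h', AEEqFun.coeFn_mul x xs, AEEqFun.coeFn_mul y ys,
        AEEqFun.coeFn_mul (ratio x w) xs, AEEqFun.coeFn_mul (ratio y w) ys, coeFn_ratio x w,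
        coeFn_ratio y w] with ω h1 h2 h3 h4 h5 h6 h7
      rw [h2, h3, Pi.mul_apply, Pi.mul_apply] at h1
      rw [h4, h5, Pi.mul_apply, Pi.mul_apply, h6, h7,
        div_mul_eq_mul_div, div_mul_eq_mul_div, h1]
    have hwt : ρ w < ∞ := hρw.trans_lt (by simp)
    have e1 := l1Norm_transfer_le hC hxw hwt hxs
    have e2 := l1Norm_transfer_le hC hyw hwt hys
    have hid : Ω x * xs - Ω y * ys = (Ω x * xs - Ω w * (ratio x w * xs))
        + (-1) * (Ω y * ys - Ω w * (ratio y w * ys)) := by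
      rw [neg_one_mul_fun, hws]
      abel
    have hneg : l1Norm ((-1) * (Ω y * ys - Ω w * (ratio y w * ys))) ≤
        l1Norm (Ω y * ys - Ω w * (ratio y w * ys)) := by
      simpa using l1Norm_mul_mul_le ae_norm_neg_one 1 (Ω y * ys - Ω w * (ratio y w * ys))
    rw [hid]
    calc _ ≤ C * p * ρ w * kotheDual ρ xs + C * q * ρ w * kotheDual ρ ys :=
          (l1Norm_add_le _ _).trans (add_le_add e1 (hneg.trans e2))
      _ ≤ C * p * 2 * kotheDual ρ xs + C * q * 2 * kotheDual ρ ys := by gcongr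
      _ = _ := by ring
  have hlim : Tendsto (fun ε : ℝ≥0 => 2 * C * ((((ρ x).toNNReal + ε : ℝ≥0) : ℝ≥0∞)
      * kotheDual ρ xs + (((ρ y).toNNReal + ε : ℝ≥0) : ℝ≥0∞) * kotheDual ρ ys)) (𝓝[>] 0)
      (𝓝 (2 * C * ((((ρ x).toNNReal + 0 : ℝ≥0) : ℝ≥0∞) * kotheDual ρ xs
        + (((ρ y).toNNReal + 0 : ℝ≥0) : ℝ≥0∞) * kotheDual ρ ys))) := by
    refine ENNReal.Tendsto.const_mul (Tendsto.add ?_ ?_) (Or.inr (by finiteness))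
    · exact ENNReal.Tendsto.mul_const (ENNReal.tendsto_coe.2
        (tendsto_const_nhds.add nhdsWithin_le_nhds)) (Or.inr hxs.ne)
    · exact ENNReal.Tendsto.mul_const (ENNReal.tendsto_coe.2
        (tendsto_const_nhds.add nhdsWithin_le_nhds)) (Or.inr hys.ne)
  rw [add_zero, add_zero, ENNReal.coe_toNNReal hx.ne, ENNReal.coe_toNNReal hy.ne] at hlim
  refine ge_of_tendsto hlim ?_
  filter_upwards [self_mem_nhdsWithin] with ε hε
  have hε' : (ε : ℝ≥0∞) ≠ 0 := by simpa using ne_of_gt hε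
  refine main _ _ ?_ ?_
  · rw [ENNReal.coe_add, ENNReal.coe_toNNReal hx.ne]
    exact ENNReal.lt_add_right hx.ne hε'
  · rw [ENNReal.coe_add, ENNReal.coe_toNNReal hy.ne]
    exact ENNReal.lt_add_right hy.ne hε'

end

section

/-! ### The comparison on truncations -/

variable {X₀ X₁ : KotheSpace μ} {θ : ℝ} {Ω : (α →ₘ[μ] ℂ) → (α →ₘ[μ] ℂ)}

lemma l1Norm_modulus (f : α →ₘ[μ] ℂ) : l1Norm (modulus f) = l1Norm f := by
  refine lintegral_congr_ae ?_
  filter_upwards [coeFn_modulus f] with ω h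
  rw [h, enorm_eq_nnnorm, enorm_eq_nnnorm]
  simp

/-- The function `f (log |x₁| - log |x₀|)` is the derivative at `θ` of a holomorphic factorization,
on the set where the logarithm is bounded. -/
theorem exists_factorization_on_truncation (hθ₀ : 0 < θ) (hθ₁ : θ < 1) {C : ℝ≥0}
    (hC : ∀ F d, InCalderon X₀ X₁ F → HasDerivInSum X₀ X₁ F θ d →
      interpNorm X₀ X₁ θ (Ω (F θ) - d) ≤ C * calderonNorm X₀ X₁ F)
    {f x₀ x₀s x₁ x₁s : α →ₘ[μ] ℂ} (hf₀ : modulus f = x₀ * x₀s) (hf₁ : modulus f = x₁ * x₁s)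
    {m M : ℝ≥0} (h₀ : X₀.nrm x₀ ≤ m) (h₁ : X₁.nrm x₁ ≤ m) (h₀s : kotheDual X₀.nrm x₀s ≤ M)
    (h₁s : kotheDual X₁.nrm x₁s ≤ M) {n : ℝ} (hn : 0 ≤ n) :
    ∃ u g d : α →ₘ[μ] ℂ, interpNorm X₀ X₁ θ u ≤ m ∧ kotheDual (interpNorm X₀ X₁ θ) g ≤ M ∧
      interpNorm X₀ X₁ θ (Ω u - d) ≤ C * m ∧
      (∀ᵐ ω ∂μ, f ω = 0 → g ω = 0) ∧
      (∀ᵐ ω ∂μ, |Real.log ‖x₁ ω‖ - Real.log ‖x₀ ω‖| ≤ n → u ω * g ω = f ω) ∧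
      (∀ᵐ ω ∂μ, |Real.log ‖x₁ ω‖ - Real.log ‖x₀ ω‖| ≤ n →
        d ω * g ω = f ω * (Real.log ‖x₁ ω‖ - Real.log ‖x₀ ω‖ : ℝ)) := by
  have hmf := f.measurable
  have hm₀ := x₀.measurable
  have hm₁ := x₁.measurable
  set L : α → ℝ := fun ω => Real.log ‖x₁ ω‖ - Real.log ‖x₀ ω‖ with hL
  have hLm : Measurable L := by fun_prop
  -- Where f ≠ 0 both x₀ and x₁ are nonzero almost everywhere, so L is a genuine logarithm of
  -- |x₁|/|x₀| on this set.
  set S : Set α := {ω | f ω ≠ 0 ∧ |L ω| ≤ n} with hS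
  have hSm : MeasurableSet S :=
    (hmf (measurableSet_singleton (0 : ℂ)).compl).inter
      (measurableSet_le (continuous_abs.measurable.comp hLm) measurable_const)
  set l : α → ℝ := S.indicator L with hl
  have hlm : Measurable l := hLm.indicator hSm
  have hln : ∀ ω, |l ω| ≤ n := fun ω => by
    by_cases h : ω ∈ S
    · rw [hl, Set.indicator_of_mem h]
      exact h.2
    · rw [hl, Set.indicator_of_notMem h, abs_zero]
      exact hn
  -- The dual factor carries the opposite exponent, turning |g| into |x₀s| at 0 and |x₁s| at 1 on
  -- `S`.
  set l' : α → ℝ := fun ω => -l ω with hl'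
  have hlm' : Measurable l' := hlm.neg
  have hln' : ∀ ω, |l' ω| ≤ n := fun ω => by
    rw [hl', abs_neg]
    exact hln ω
  -- On `S` the modulus of this function is |x₀|^(1-θ)|x₁|^θ.
  have hum : Measurable (S.indicator fun ω => x₀ ω * ((Real.exp (θ * L ω) : ℝ) : ℂ)) :=
    Measurable.indicator (by fun_prop) hSm
  have hgm : Measurable (S.indicator fun ω => f ω / (x₀ ω * ((Real.exp (θ * L ω) : ℝ) : ℂ))) :=
    Measurable.indicator (by fun_prop) hSm
  set u : α →ₘ[μ] ℂ := ofFun _ hum with hu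
  set g : α →ₘ[μ] ℂ := ofFun _ hgm with hg
  have huω := coeFn_ofFun (μ := μ) _ hum
  have hgω := coeFn_ofFun (μ := μ) _ hgm
  rw [← hu] at huω
  rw [← hg] at hgω
  have hfac : ∀ {y ys : α →ₘ[μ] ℂ}, modulus f = y * ys →
      ∀ᵐ ω ∂μ, ((‖f ω‖ : ℝ) : ℂ) = y ω * ys ω := by
    intro y ys hy
    have hcoe := coeFn_modulus f
    rw [hy] at hcoe
    filter_upwards [hcoe, AEEqFun.coeFn_mul y ys] with ω h1 h2
    rw [← h1, h2, Pi.mul_apply]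
  have hne : ∀ᵐ ω ∂μ, ω ∈ S → 0 < ‖x₀ ω‖ ∧ 0 < ‖x₁ ω‖ ∧ ‖x₁ ω‖ = ‖x₀ ω‖ * Real.exp (L ω) ∧
      ‖x₀s ω‖ = ‖f ω‖ / ‖x₀ ω‖ ∧ ‖x₁s ω‖ = ‖f ω‖ / ‖x₁ ω‖ := by
    filter_upwards [hfac hf₀, hfac hf₁] with ω h1 h2 hω
    have hnf : ((‖f ω‖ : ℝ) : ℂ) ≠ 0 := by simpa using hω.1
    have e0 : 0 < ‖x₀ ω‖ := norm_pos_iff.2 (left_ne_zero_of_mul (h1 ▸ hnf))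
    have e1 : 0 < ‖x₁ ω‖ := norm_pos_iff.2 (left_ne_zero_of_mul (h2 ▸ hnf))
    have n1 := congrArg norm h1
    have n2 := congrArg norm h2
    rw [Complex.norm_real, norm_norm, norm_mul] at n1 n2
    refine ⟨e0, e1, ?_, ?_, ?_⟩
    · rw [hL]
      simp only
      rw [Real.exp_sub, Real.exp_log e1, Real.exp_log e0]
      field_simp
    · rw [n1]
      field_simp
    · rw [n2]
      field_simp
  have hm := isMultiplier_expMult (μ := μ) hθ₀ hθ₁ hlm hln hn
  have hu₀ : ∀ᵐ ω ∂μ, ‖(expMult μ θ hlm 0 * u) ω‖ ≤ ‖x₀ ω‖ := by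
    filter_upwards [ae_norm_expMult (μ := μ) (θ := θ) hlm 0,
      AEEqFun.coeFn_mul (expMult μ θ hlm 0) u, huω] with ω h1 h2 h3
    rw [h2, Pi.mul_apply, norm_mul, h1, h3, hl]
    by_cases h : ω ∈ S
    · rw [Set.indicator_of_mem h, Set.indicator_of_mem h, norm_mul, Complex.norm_real,
        Real.norm_of_nonneg (Real.exp_pos _).le, mul_left_comm, ← Real.exp_add]
      simp
    · simp [Set.indicator_of_notMem h]
  have hu₁ : ∀ᵐ ω ∂μ, ‖(expMult μ θ hlm 1 * u) ω‖ ≤ ‖x₁ ω‖ := by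
    filter_upwards [ae_norm_expMult (μ := μ) (θ := θ) hlm 1,
      AEEqFun.coeFn_mul (expMult μ θ hlm 1) u, huω, hne] with ω h1 h2 h3 h4
    rw [h2, Pi.mul_apply, norm_mul, h1, h3, hl]
    by_cases h : ω ∈ S
    · rw [Set.indicator_of_mem h, Set.indicator_of_mem h, norm_mul, Complex.norm_real,
        Real.norm_of_nonneg (Real.exp_pos _).le, mul_left_comm, ← Real.exp_add, (h4 h).2.2.1,
        Complex.one_re]
      ring_nf
      exact le_rfl
    · simp [Set.indicator_of_notMem h]
  have hg₀ : ∀ᵐ ω ∂μ, ‖(expMult μ θ hlm' 0 * g) ω‖ ≤ ‖x₀s ω‖ := by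
    filter_upwards [ae_norm_expMult (μ := μ) (θ := θ) hlm' 0,
      AEEqFun.coeFn_mul (expMult μ θ hlm' 0) g, hgω, hne] with ω h1 h2 h3 h4
    rw [h2, Pi.mul_apply, norm_mul, h1, h3, hl', hl]
    by_cases h : ω ∈ S
    · rw [Set.indicator_of_mem h, (h4 h).2.2.2.1]
      simp only [Set.indicator_of_mem h]
      rw [norm_div, norm_mul, Complex.norm_real, Real.norm_of_nonneg (Real.exp_pos _).le,
        Complex.zero_re, show (0 - θ) * -L ω = θ * L ω by ring]
      have := (h4 h).1
      refine le_of_eq ?_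
      field_simp
    · simp [Set.indicator_of_notMem h]
  have hg₁ : ∀ᵐ ω ∂μ, ‖(expMult μ θ hlm' 1 * g) ω‖ ≤ ‖x₁s ω‖ := by
    filter_upwards [ae_norm_expMult (μ := μ) (θ := θ) hlm' 1,
      AEEqFun.coeFn_mul (expMult μ θ hlm' 1) g, hgω, hne] with ω h1 h2 h3 h4
    rw [h2, Pi.mul_apply, norm_mul, h1, h3, hl', hl]
    by_cases h : ω ∈ S
    · rw [Set.indicator_of_mem h, (h4 h).2.2.2.2, (h4 h).2.2.1]
      simp only [Set.indicator_of_mem h]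
      rw [norm_div, norm_mul, Complex.norm_real, Real.norm_of_nonneg (Real.exp_pos _).le,
        Complex.one_re, show (1 - θ) * -L ω = θ * L ω - L ω by ring, Real.exp_sub]
      have := (h4 h).1
      refine le_of_eq ?_
      field_simp
    · simp [Set.indicator_of_notMem h]
  -- The truncation puts u in both spaces, so the constant function u is in the Calderón space and
  -- the exponential multiplies it. The bound obtained here depends on n, but only finiteness is
  -- used.
  have hfinite : ∀ (X : KotheSpace μ) (z : ℂ) (y : α →ₘ[μ] ℂ), z ∈ closedStrip →
      X.nrm y ≤ m → (∀ᵐ ω ∂μ, ‖(expMult μ θ hlm z * u) ω‖ ≤ ‖y ω‖) → X.nrm u < ∞ := by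
    intro X z y hz hy hle
    refine (X.nrm_mono _ _ (ae_norm_le_expMult_mul hθ₀ hθ₁ hlm hln hz u)).trans_lt ?_
    rw [X.nrm_smul]
    exact ENNReal.mul_lt_top (by simp)
      (((X.nrm_mono _ _ hle).trans hy).trans_lt ENNReal.coe_lt_top)
  have hconst : InCalderon X₀ X₁ fun _ => u :=
    inCalderon_const (hfinite X₀ 0 x₀ (by simp [closedStrip]) h₀ hu₀)
      (hfinite X₁ 1 x₁ (by simp [closedStrip]) h₁ hu₁)
  have hF := hconst.mul hm
  have hθ := theta_mem hθ₀ hθ₁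
  have hd := (hasDerivInSum_const (X₀ := X₀) (X₁ := X₁) u (θ : ℂ)).mul hm hθ
    (hconst.eventually_lt_top hθ)
  rw [mul_comm (expMult μ θ hlm θ), zero_mul_fun, zero_add] at hd
  have hFθ : (expMult μ θ hlm * fun _ => u : ℂ → α →ₘ[μ] ℂ) (θ : ℂ) = u := by
    rw [Pi.mul_apply, expMult_theta, one_mul]
  have hnorm : calderonNorm X₀ X₁ (expMult μ θ hlm * fun _ => u) ≤ m := by
    have hmul : ∀ (z z' : ℂ), (∀ᵐ ω ∂μ, ‖expMult μ θ hlm z ω‖ = ‖expMult μ θ hlm z' ω‖) →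
        ∀ᵐ ω ∂μ, ‖(expMult μ θ hlm z * u) ω‖ ≤ ‖(expMult μ θ hlm z' * u) ω‖ := by
      intro z z' h
      simp_rw [mul_comm _ u]
      exact norm_mul_le_mul_of_le u (h.mono fun ω h => h.le)
    exact calderonNorm_le_iff.2 ⟨fun t => ((X₀.nrm_mono _ _ (hmul _ _
        (ae_norm_expMult_left hlm t))).trans (X₀.nrm_mono _ _ hu₀)).trans h₀,
      fun t => ((X₁.nrm_mono _ _ (hmul _ _
        (ae_norm_expMult_right hlm t))).trans (X₁.nrm_mono _ _ hu₁)).trans h₁⟩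
  have hug : ∀ᵐ ω ∂μ, |L ω| ≤ n → u ω * g ω = f ω := by
    filter_upwards [huω, hgω, hne] with ω h1 h2 h3 hω
    rw [h1, h2]
    by_cases h : f ω = 0
    · have : ω ∉ S := fun h' => h'.1 h
      simp [Set.indicator_of_notMem this, h]
    · have hωS : ω ∈ S := ⟨h, hω⟩
      rw [Set.indicator_of_mem hωS, Set.indicator_of_mem hωS]
      refine mul_div_cancel₀ _ (mul_ne_zero (norm_pos_iff.1 (h3 hωS).1) ?_)
      exact_mod_cast (Real.exp_pos _).ne'
  refine ⟨u, g, expMultDeriv μ θ hlm θ * u, (interpNorm_le hF hFθ).trans hnorm,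
    kotheDual_interpNorm_le hθ₀ hθ₁ hlm' hln' hn ((kotheDual_mono hg₀).trans h₀s)
      ((kotheDual_mono hg₁).trans h₁s), ?_, ?_, hug, ?_⟩
  · have h := hC _ _ hF hd
    rw [hFθ] at h
    exact h.trans (by gcongr)
  · filter_upwards [hgω] with ω h1 h2
    rw [h1, Set.indicator_of_notMem]
    exact fun h' => h'.1 h2
  · filter_upwards [hug, hgω, AEEqFun.coeFn_mul (expMultDeriv μ θ hlm θ) u,
      coeFn_ofFun (μ := μ) (fun ω => (l ω : ℂ) * Complex.exp (((θ : ℂ) - θ) * l ω)) (by fun_prop)]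
      with ω h1 h2 h3 h4 hω
    have h5 : expMultDeriv μ θ hlm θ ω = l ω := by
      refine (show expMultDeriv μ θ hlm θ ω = _ from h4).trans ?_
      simp
    rw [h3, Pi.mul_apply, mul_assoc, h1 hω, h5, mul_comm]
    by_cases h : f ω = 0
    · simp [h]
    · rw [hl, Set.indicator_of_mem (show ω ∈ S from ⟨h, hω⟩)]

/-- The comparison of an upload with the logarithmic formula on the set where the logarithm is
bounded by `n`. -/
theorem setLIntegral_truncation_le (hθ₀ : 0 < θ) (hθ₁ : θ < 1) {C C' : ℝ≥0}
    (hC : ∀ F d, InCalderon X₀ X₁ F → HasDerivInSum X₀ X₁ F θ d →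
      interpNorm X₀ X₁ θ (Ω (F θ) - d) ≤ C * calderonNorm X₀ X₁ F)
    (hC' : ∀ (a x : α →ₘ[μ] ℂ) (c : ℝ≥0), (∀ᵐ ω ∂μ, ‖a ω‖ ≤ c) → interpNorm X₀ X₁ θ x < ∞ →
      interpNorm X₀ X₁ θ (Ω (a * x) - a * Ω x) ≤ C' * c * interpNorm X₀ X₁ θ x)
    {K' : ℝ≥0} {f x xs x₀ x₀s x₁ x₁s : α →ₘ[μ] ℂ}
    (hx : IsAlmostOptimal (interpNorm X₀ X₁ θ) K' f x xs)
    (hf₀ : modulus f = x₀ * x₀s) (hf₁ : modulus f = x₁ * x₁s)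
    {m M : ℝ≥0} (h₀ : X₀.nrm x₀ ≤ m) (h₁ : X₁.nrm x₁ ≤ m) (h₀s : kotheDual X₀.nrm x₀s ≤ M)
    (h₁s : kotheDual X₁.nrm x₁s ≤ M) {n : ℝ} (hn : 0 ≤ n) :
    ∫⁻ ω in {ω | f ω = 0 ∨ |Real.log ‖x₁ ω‖ - Real.log ‖x₀ ω‖| ≤ n},
      ‖(Ω x * xs) ω - f ω * ((Real.log ‖x₁ ω‖ - Real.log ‖x₀ ω‖ : ℝ) : ℂ)‖ₑ ∂μ
      ≤ 2 * C' * (K' * l1Norm f + m * M) + C * (m * M) := by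
  obtain ⟨u, g, d, hu, hg, hd, hgz, hug, hdg⟩ :=
    exists_factorization_on_truncation hθ₀ hθ₁ hC hf₀ hf₁ h₀ h₁ h₀s h₁s hn
  set A : Set α := {ω | f ω = 0 ∨ |Real.log ‖x₁ ω‖ - Real.log ‖x₀ ω‖| ≤ n} with hA
  have hAm : MeasurableSet A := by
    have hm₀ := x₀.measurable
    have hm₁ := x₁.measurable
    have hLm : Measurable fun ω => Real.log ‖x₁ ω‖ - Real.log ‖x₀ ω‖ := by fun_prop
    exact (f.measurable (measurableSet_singleton (0 : ℂ))).union
      (measurableSet_le (continuous_abs.measurable.comp hLm) measurable_const)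
  have hu' : interpNorm X₀ X₁ θ u < ∞ := hu.trans_lt ENNReal.coe_lt_top
  have hg' : kotheDual (interpNorm X₀ X₁ θ) g < ∞ := hg.trans_lt ENNReal.coe_lt_top
  have hindm : ∀ y : α →ₘ[μ] ℂ, Measurable (A.indicator y) := fun y => y.measurable.indicator hAm
  -- Cutting only the dual factors down to A makes the two products equal everywhere while x and u,
  -- and so Ω x and Ω u, stay untouched.
  set ys : α →ₘ[μ] ℂ := ofFun _ (hindm xs) with hys
  set v : α →ₘ[μ] ℂ := ofFun _ (hindm g) with hv
  have hysω := coeFn_ofFun (μ := μ) _ (hindm xs)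
  have hvω := coeFn_ofFun (μ := μ) _ (hindm g)
  rw [← hys] at hysω
  rw [← hv] at hvω
  have hind_le : ∀ (y : α → ℂ) (ω : α), ‖A.indicator y ω‖ ≤ ‖y ω‖ :=
    fun y ω => norm_indicator_le_norm_self _ _
  have hysle : kotheDual (interpNorm X₀ X₁ θ) ys ≤ kotheDual (interpNorm X₀ X₁ θ) xs :=
    kotheDual_mono (hysω.mono fun ω h => by rw [h]; exact hind_le _ ω)
  have hvle : kotheDual (interpNorm X₀ X₁ θ) v ≤ kotheDual (interpNorm X₀ X₁ θ) g :=
    kotheDual_mono (hvω.mono fun ω h => by rw [h]; exact hind_le _ ω)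
  have hprod : x * ys = u * v := by
    have hxω : f =ᵐ[μ] (x * xs : α →ₘ[μ] ℂ) := by rw [← hx.eq_mul]
    apply AEEqFun.ext
    filter_upwards [hysω, hvω, AEEqFun.coeFn_mul x ys, AEEqFun.coeFn_mul u v, hxω,
      AEEqFun.coeFn_mul x xs, hug, hgz] with ω h1 h2 h3 h4 h5 h6 h7 h8
    rw [h3, h4, Pi.mul_apply, Pi.mul_apply, h1, h2]
    by_cases h : ω ∈ A
    · rw [Set.indicator_of_mem h, Set.indicator_of_mem h]
      have h9 : x ω * xs ω = f ω := by rw [h5, h6, Pi.mul_apply]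
      rw [h9]
      rcases h with h | h
      · rw [h8 h, h, mul_zero]
      · exact (h7 h).symm
    · rw [Set.indicator_of_notMem h, Set.indicator_of_notMem h, mul_zero, mul_zero]
  have hdiff := l1Norm_factorization_sub_le hC' hprod hx.mem (hysle.trans_lt hx.mem_dual) hu'
    (hvle.trans_lt hg')
  have hder : l1Norm ((Ω u - d) * v) ≤ C * m * M :=
    (l1Norm_mul_le_interpNorm (hd.trans_lt (ENNReal.mul_lt_top (by simp) (by simp)))
      (hvle.trans_lt hg')).trans (by gcongr; exact hvle.trans hg)
  calc ∫⁻ ω in A, ‖(Ω x * xs) ω - f ω * ((Real.log ‖x₁ ω‖ - Real.log ‖x₀ ω‖ : ℝ) : ℂ)‖ₑ ∂μ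
      ≤ ∫⁻ ω in A, ‖((Ω x * ys - Ω u * v) + (Ω u - d) * v) ω‖ₑ ∂μ := by
        refine setLIntegral_mono_ae' hAm ?_
        filter_upwards [hysω, hvω, AEEqFun.coeFn_mul (Ω x) xs, AEEqFun.coeFn_mul (Ω x) ys,
          AEEqFun.coeFn_mul (Ω u) v, AEEqFun.coeFn_mul (Ω u - d) v, AEEqFun.coeFn_sub (Ω u) d,
          AEEqFun.coeFn_sub (Ω x * ys) (Ω u * v),
          AEEqFun.coeFn_add (Ω x * ys - Ω u * v) ((Ω u - d) * v), hdg, hgz]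
          with ω h1 h2 h3 h4 h5 h6 h7 h8 h9 h10 h11 hω
        refine le_of_eq ?_
        rw [h9, Pi.add_apply, h8, h6, Pi.sub_apply, Pi.mul_apply, h7, Pi.sub_apply, h4, h5,
          Pi.mul_apply, Pi.mul_apply, h3, Pi.mul_apply, h1, h2, Set.indicator_of_mem hω,
          Set.indicator_of_mem hω]
        have h12 : d ω * g ω = f ω * ((Real.log ‖x₁ ω‖ - Real.log ‖x₀ ω‖ : ℝ) : ℂ) := by
          rcases hω with h | h
          · rw [h11 h, h, mul_zero, zero_mul]
          · exact h10 h
        rw [← h12]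
        ring_nf
    _ ≤ l1Norm ((Ω x * ys - Ω u * v) + (Ω u - d) * v) := setLIntegral_le_lintegral _ _
    _ ≤ 2 * C' * (interpNorm X₀ X₁ θ x * kotheDual (interpNorm X₀ X₁ θ) ys
        + interpNorm X₀ X₁ θ u * kotheDual (interpNorm X₀ X₁ θ) v) + C * m * M :=
        (l1Norm_add_le _ _).trans (add_le_add hdiff hder)
    _ ≤ 2 * C' * (K' * l1Norm f + m * M) + C * (m * M) := by
        rw [mul_assoc (C : ℝ≥0∞)]
        have h1 := (mul_le_mul' le_rfl hysle).trans hx.le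
        have h2 := mul_le_mul' hu (hvle.trans hg)
        gcongr

end

end KotheSpace

end

theorem mainTheorem10 {α : Type*} [MeasurableSpace α] (μ : Measure α) [SigmaFinite μ]
    (X₀ X₁ : KotheSpace μ) (hreg : KotheSpace.IsRegularPair X₀ X₁)
    (θ : ℝ) (hθ₀ : 0 < θ) (hθ₁ : θ < 1)
    (Ω : (α →ₘ[μ] ℂ) → (α →ₘ[μ] ℂ)) (hΩ : KotheSpace.IsDifferential X₀ X₁ θ Ω)
    (U : (α →ₘ[μ] ℂ) → (α →ₘ[μ] ℂ))
    (hU : KotheSpace.IsUpload (KotheSpace.interpNorm X₀ X₁ θ) Ω U)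
    (K : ℝ≥0) :
    ∃ C : ℝ≥0, ∀ f x₀ x₀s x₁ x₁s : α →ₘ[μ] ℂ,
      KotheSpace.l1Norm f < ∞ →
      KotheSpace.IsAlmostOptimal X₀.nrm K (KotheSpace.modulus f) x₀ x₀s →
      KotheSpace.IsAlmostOptimal X₁.nrm K (KotheSpace.modulus f) x₁ x₁s →
      X₀.nrm x₀ ≤ K * X₁.nrm x₁ → X₁.nrm x₁ ≤ K * X₀.nrm x₀ →
      ∫⁻ ω, ‖U f ω - f ω * ((Real.log ‖x₁ ω‖ - Real.log ‖x₀ ω‖ : ℝ) : ℂ)‖ₑ ∂μ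
        ≤ C * KotheSpace.l1Norm f := by
  obtain ⟨C, hC⟩ := hΩ.exists_interpNorm_sub_le hθ₀ hθ₁
  obtain ⟨C', hC'⟩ := hΩ.exists_interpNorm_commutator_le hθ₀ hθ₁
  obtain ⟨K', hK'⟩ := hU
  refine ⟨2 * C' * (K' + max 1 K * K) + C * (max 1 K * K),
    fun f x₀ x₀s x₁ x₁s hf h₀ h₁ h₀₁ h₁₀ => ?_⟩
  obtain ⟨x, xs, hx, hUf⟩ := hK' f hf
  rw [hUf]
  have hle := h₀.le
  have hle' := h₁.le
  rw [KotheSpace.l1Norm_modulus] at hle hle'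
  -- The product m M contains the mixed terms ‖x₀‖‖x₁^*‖ and ‖x₁‖‖x₀^*‖. The normalization trades
  -- one norm for the other, leaving the two optimal products; max 1 K appears because K may be less
  -- than 1.
  set m : ℝ≥0∞ := max (X₀.nrm x₀) (X₁.nrm x₁) with hm
  set M : ℝ≥0∞ := max (KotheSpace.kotheDual X₀.nrm x₀s) (KotheSpace.kotheDual X₁.nrm x₁s) with hM
  have hmt : m ≠ ∞ := (max_lt h₀.mem h₁.mem).ne
  have hMt : M ≠ ∞ := (max_lt h₀.mem_dual h₁.mem_dual).ne
  have hone : ∀ a : ℝ≥0∞, a ≤ (max 1 K : ℝ≥0) * a := fun a =>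
    le_mul_of_one_le_left' (by exact_mod_cast le_max_left 1 K)
  have hK : ∀ a : ℝ≥0∞, K * a ≤ (max 1 K : ℝ≥0) * a := fun a =>
    mul_le_mul' (by exact_mod_cast le_max_right 1 K) le_rfl
  have hm₀ : m ≤ (max 1 K : ℝ≥0) * X₀.nrm x₀ := max_le (hone _) (h₁₀.trans (hK _))
  have hm₁ : m ≤ (max 1 K : ℝ≥0) * X₁.nrm x₁ := max_le (h₀₁.trans (hK _)) (hone _)
  have hmM : m * M ≤ (max 1 K : ℝ≥0) * K * KotheSpace.l1Norm f := by
    rw [mul_assoc, hM, mul_max]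
    refine max_le ((mul_le_mul' hm₀ le_rfl).trans ?_) ((mul_le_mul' hm₁ le_rfl).trans ?_)
    · rw [mul_assoc]
      gcongr
    · rw [mul_assoc]
      gcongr
  set A : ℕ → Set α := fun n =>
    {ω | f ω = 0 ∨ |Real.log ‖x₁ ω‖ - Real.log ‖x₀ ω‖| ≤ n} with hA
  have hmono : Monotone A := fun i j hij ω hω => hω.imp_right fun h =>
    h.trans (Nat.cast_le.2 hij)
  -- Since `Real.log 0 = 0`, the difference of logarithms is a finite real at every point, and the
  -- truncation sets exhaust the space.
  have hunion : ⋃ n, A n = Set.univ := Set.eq_univ_of_forall fun ω => by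
    obtain ⟨n, hn⟩ := exists_nat_ge |Real.log ‖x₁ ω‖ - Real.log ‖x₀ ω‖|
    exact Set.mem_iUnion.2 ⟨n, Or.inr hn⟩
  -- The integral is the supremum over the increasing sets A n, so a bound that does not depend on n
  -- is enough.
  rw [← setLIntegral_univ, ← hunion, setLIntegral_iUnion_of_directed _ hmono.directed_le]
  refine iSup_le fun n => ?_
  refine (KotheSpace.setLIntegral_truncation_le hθ₀ hθ₁ hC hC' hx h₀.eq_mul h₁.eq_mul
    (m := m.toNNReal) (M := M.toNNReal) ?_ ?_ ?_ ?_ n.cast_nonneg).trans ?_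
  · rw [ENNReal.coe_toNNReal hmt]
    exact le_max_left _ _
  · rw [ENNReal.coe_toNNReal hmt]
    exact le_max_right _ _
  · rw [ENNReal.coe_toNNReal hMt]
    exact le_max_left _ _
  · rw [ENNReal.coe_toNNReal hMt]
    exact le_max_right _ _
  · rw [ENNReal.coe_toNNReal hmt, ENNReal.coe_toNNReal hMt]
    calc 2 * (C' : ℝ≥0∞) * (K' * KotheSpace.l1Norm f + m * M) + C * (m * M)
        ≤ 2 * C' * (K' * KotheSpace.l1Norm f + (max 1 K : ℝ≥0) * K * KotheSpace.l1Norm f)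
          + C * ((max 1 K : ℝ≥0) * K * KotheSpace.l1Norm f) := by gcongr
      _ = _ := by
        push_cast
        ring
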